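/- For $n\ge 1$, the *regular $n$-simplex* is the set $\{\mathbf e_1,\dots,\mathbf e_n\}\subset\mathbb R^n$ of standard basis vectors. A *Steiner tree* of a finite set $P\subset\mathbb R^n$ of terminals is a spanning tree of $P\cup S$ for some finite $S\subset\mathbb R^n\setminus P$, whose elements are the Steiner points; its cost is the sum of the Euclidean lengths of its edges. It is *optimal* if its cost is least among all Steiner trees of $P$ (over all choices of $S$) and no Steiner point has degree $2$ (i.e. no Steiner point merely subdivides an edge). It is *full* if $|S|=|P|-2$, and *candidate-optimal* if any two edges with a common endpoint include an angle of at least $120^\circ$ and every Steiner point has degree exactly $3$. The *split* of $\mathbf x\in\mathbb R^d$ is $\mathbf x'=(\tfrac{x_1}{2},\tfrac{x_1}{2},\dots,\tfrac{x_d}{2},\tfrac{x_d}{2})\in\mathbb R^{2d}$. A *Fermat point* of a triangle is a point, different from the three vertices, that minimizes the sum of the distances to the vertices. **Theorem (Doubling the Tree).** Let $d\ge 3$ and let $T$ be an optimal Steiner tree of the regular $d$-simplex, with set of Steiner points $S$. Then every terminal $\mathbf e_i$ of $T$ has exactly one neighbour $\mathbf s_i$ in $T$, and $\mathbf s_i\in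 S$; for each $i=1,\dots,d$ the triangle $\mathbf e_{2i-1}\mathbf e_{2i}\mathbf s_i'$ in $\mathbb R^{2d}$ has a unique Fermat point $\mathbf x_i$; and the graph $T'$ with terminals $\mathbf e_1,\dots,\mathbf e_{2d}$, Steiner points $\{\mathbf s':\mathbf s\in S\}\cup\{\mathbf x_1,\dots,\mathbf x_d\}$ and edges - $(\mathbf r',\mathbf s')$ for all $\mathbf r,\mathbf s\in S$ with $(\mathbf r,\mathbf s)\in E(T)$, - $(\mathbf e_{2i-1},\mathbf x_i)$, $(\mathbf e_{2i},\mathbf x_i)$ and $(\mathbf x_i,\mathbf s_i')$ for $i=1,\dots,d$, is a full, candidate-optimal Steiner tree of the regular $2d$-simplex. Moreover, any two edges of $T'$ with a common endpoint include an angle of exactly $120^\circ$. -/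

import Mathlib

/-- The Euclidean length of an edge. -/
noncomputable def edgeLength {n : ℕ} : Sym2 (EuclideanSpace ℝ (Fin n)) → ℝ :=
  Sym2.lift ⟨fun x y => dist x y, fun x y => dist_comm x y⟩

/-- The cost of a geometric graph: the sum of the lengths of its edges
(used only for graphs with finitely many edges). -/
noncomputable def graphCost {n : ℕ} (G : SimpleGraph (EuclideanSpace ℝ (Fin n))) : ℝ :=
  ∑ᶠ e ∈ G.edgeSet, edgeLength e

/-- `(S, G)` is a Steiner tree of the terminal set `P`: `S` is a finite set of additional points
(the Steiner points) and `G` is a spanning tree of `P ∪ S`. The graph `G` is a graph on the whole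
space, all of whose edges join points of `P ∪ S`. -/
structure IsSteinerTree {n : ℕ} (P S : Finset (EuclideanSpace ℝ (Fin n)))
    (G : SimpleGraph (EuclideanSpace ℝ (Fin n))) : Prop where
  disjoint : Disjoint P S
  edges_mem : ∀ x y, G.Adj x y → x ∈ P ∪ S ∧ y ∈ P ∪ S
  isTree : (G.induce {x | x ∈ P ∪ S}).IsTree

/-- An optimal Steiner tree of `P`: a Steiner tree of least cost among all Steiner trees of `P`
(over all finite sets of Steiner points), with the usual convention that there are no trivial
Steiner points, i.e. no Steiner point (of degree two) that merely subdivides an edge. -/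
structure IsOptimalSteinerTree {n : ℕ} (P S : Finset (EuclideanSpace ℝ (Fin n)))
    (G : SimpleGraph (EuclideanSpace ℝ (Fin n))) : Prop extends IsSteinerTree P S G where
  cost_le : ∀ (S' : Finset (EuclideanSpace ℝ (Fin n)))
    (G' : SimpleGraph (EuclideanSpace ℝ (Fin n))),
    IsSteinerTree P S' G' → graphCost G ≤ graphCost G'
  no_subdivision : ∀ s ∈ S, (G.neighborSet s).ncard ≠ 2

/-- A full Steiner tree: a Steiner tree of `n` terminals with exactly `n - 2` Steiner points. -/
structure IsFullSteinerTree {n : ℕ} (P S : Finset (EuclideanSpace ℝ (Fin n)))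
    (G : SimpleGraph (EuclideanSpace ℝ (Fin n))) : Prop extends IsSteinerTree P S G where
  card_steiner : S.card + 2 = P.card

/-- A candidate-optimal Steiner tree: any two edges at a common vertex include an angle of at
least 120 degrees, and every Steiner point has degree exactly three. -/
structure IsCandidateOptimal {n : ℕ} (P S : Finset (EuclideanSpace ℝ (Fin n)))
    (G : SimpleGraph (EuclideanSpace ℝ (Fin n))) : Prop extends IsSteinerTree P S G where
  angle_ge : ∀ v a b, G.Adj v a → G.Adj v b → a ≠ b →
    2 * Real.pi / 3 ≤ EuclideanGeometry.angle a v b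
  degree_eq : ∀ s ∈ S, (G.neighborSet s).ncard = 3

/-- The `i`-th terminal `e_i` of the regular simplex. -/
noncomputable def simplexVertex (n : ℕ) (i : Fin n) : EuclideanSpace ℝ (Fin n) :=
  EuclideanSpace.single i (1 : ℝ)

open Classical in
/-- The regular `n`-simplex (with `n` vertices): the standard basis vectors of `ℝⁿ`. -/
noncomputable def regularSimplex (n : ℕ) : Finset (EuclideanSpace ℝ (Fin n)) :=
  Finset.univ.image (simplexVertex n)

/-- The split of a point: `(x₁/2, x₁/2, …, x_d/2, x_d/2)`. -/
noncomputable def splitPoint {d : ℕ} (x : EuclideanSpace ℝ (Fin d)) :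
    EuclideanSpace ℝ (Fin (2 * d)) :=
  WithLp.toLp 2 fun k => x ⟨k.val / 2, by have := k.isLt; omega⟩ / 2

/-- The first of the two new terminals belonging to `e_i` (with 1-based indices, `e_{2i-1}`). -/
noncomputable def leftTerminal {d : ℕ} (i : Fin d) : EuclideanSpace ℝ (Fin (2 * d)) :=
  simplexVertex (2 * d) ⟨2 * i.val, by have := i.isLt; omega⟩

/-- The second of the two new terminals belonging to `e_i` (with 1-based indices, `e_{2i}`). -/
noncomputable def rightTerminal {d : ℕ} (i : Fin d) : EuclideanSpace ℝ (Fin (2 * d)) :=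
  simplexVertex (2 * d) ⟨2 * i.val + 1, by have := i.isLt; omega⟩

/-- `x` is a Fermat point of the triangle `a b c`, i.e. the Steiner point of an optimal Steiner
tree of its vertices: it minimizes the sum of the distances to the three vertices and is not
itself a vertex. (A triangle with an angle of at least 120 degrees has none.) -/
def IsFermatPoint {n : ℕ} (a b c x : EuclideanSpace ℝ (Fin n)) : Prop :=
  x ≠ a ∧ x ≠ b ∧ x ≠ c ∧
    ∀ y, dist x a + dist x b + dist x c ≤ dist y a + dist y b + dist y c

open Classical in
/-- The Steiner points of the doubled tree: the splits of the old Steiner points and the new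
points `x_i`. -/
noncomputable def doubledSteiner {d : ℕ} (S : Finset (EuclideanSpace ℝ (Fin d)))
    (x : Fin d → EuclideanSpace ℝ (Fin (2 * d))) : Finset (EuclideanSpace ℝ (Fin (2 * d))) :=
  S.image splitPoint ∪ Finset.univ.image x

/-- The edges of the doubled tree: `(r', q')` for every old edge `(r, q)` between Steiner points,
and `(e_{2i-1}, x_i)`, `(e_{2i}, x_i)`, `(x_i, s_i')` for every `i`. -/
def doubledGraph {d : ℕ} (S : Finset (EuclideanSpace ℝ (Fin d)))
    (G : SimpleGraph (EuclideanSpace ℝ (Fin d))) (s : Fin d → EuclideanSpace ℝ (Fin d))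
    (x : Fin d → EuclideanSpace ℝ (Fin (2 * d))) :
    SimpleGraph (EuclideanSpace ℝ (Fin (2 * d))) :=
  SimpleGraph.fromRel fun u v =>
    (∃ r ∈ S, ∃ q ∈ S, G.Adj r q ∧ u = splitPoint r ∧ v = splitPoint q) ∨
    (∃ i, u = leftTerminal i ∧ v = x i) ∨
    (∃ i, u = rightTerminal i ∧ v = x i) ∨
    (∃ i, u = x i ∧ v = splitPoint (s i))

/-! Splitting is a linear similarity of ratio `1 / √2`, so the 120 degree angles of `T` survive it.
The split of `e_i` is the midpoint of the two new terminals, and their difference is orthogonal to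
every split point. The triangle formed by them and `s_i'` is therefore isosceles with axis the line
through `e_i'` and `s_i'`, and its Fermat point, if there is one, lies on that axis. Elementary
trigonometry puts it at the split of the point of `[e_i, s_i]` at distance `1 / √3` from `e_i`. Seen
from `s_i'`, the new neighbour `x_i` thus lies in the direction of the old one `e_i'`, and all
angles are 120 degrees.

This works as soon as every terminal edge is longer than `1 / √3`, which is the heart of the matter
(`one_lt_three_mul_dist_sq`). Local surgery on an optimal tree gives angles of at least 120 degrees
and hence degree three at Steiner points. Working inwards from the terminals, each branch can then
be collapsed to one straight edge ending in a convex combination of its terminals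
(`exists_hullPoint`). At a Steiner point next to `e_i` there results a three-legged star over `e_i`,
`p`, `q`; disjoint branches have disjoint supports, so these ends are mutually orthogonal, and the
law of cosines bounds the leg to `e_i` from below (`one_lt_three_mul_sq_of_orthogonal_star`). The
same collapse shows that terminals are leaves: two branches at a terminal would enclose at most 90
degrees.

It remains to see that no two new vertices coincide. The doubled graph is then connected, because
the old tree maps into it, and a degree count makes it a tree with `2 * d - 2` Steiner points. -/

/-! ### Unit vectors and angles -/

section Geometry

variable {E : Type*} [NormedAddCommGroup E] [InnerProductSpace ℝ E]

/-- The unit vector pointing from `v` to `a`. -/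
noncomputable def unitDir (v a : E) : E := ‖a - v‖⁻¹ • (a - v)

theorem norm_unitDir {v a : E} (h : a ≠ v) : ‖unitDir v a‖ = 1 := by
  rw [unitDir, norm_smul, norm_inv, norm_norm]
  exact inv_mul_cancel₀ (norm_ne_zero_iff.2 (sub_ne_zero.2 h))

theorem norm_smul_unitDir (v a : E) : ‖a - v‖ • unitDir v a = a - v := by
  by_cases h : a = v
  · simp [h, unitDir]
  · rw [unitDir, smul_smul, mul_inv_cancel₀ (norm_ne_zero_iff.2 (sub_ne_zero.2 h)), one_smul]

theorem unitDir_swap (v a : E) : unitDir a v = -unitDir v a := by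
  rw [unitDir, unitDir, norm_sub_rev, ← smul_neg, neg_sub]

theorem unitDir_add_smul {v u : E} (hu : ‖u‖ = 1) {t : ℝ} (ht : 0 < t) :
    unitDir v (v + t • u) = u := by
  rw [unitDir, add_sub_cancel_left, norm_smul, hu, Real.norm_of_nonneg ht.le, mul_one, smul_smul,
    inv_mul_cancel₀ ht.ne', one_smul]

theorem angle_eq_arccos_unitDir (v a b : E) :
    EuclideanGeometry.angle a v b = Real.arccos (inner ℝ (unitDir v a) (unitDir v b)) := by
  simp only [EuclideanGeometry.angle, InnerProductGeometry.angle, unitDir, vsub_eq_sub,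
    real_inner_smul_left, real_inner_smul_right]
  congr 1
  rw [div_eq_mul_inv, mul_inv]
  ring

theorem arccos_neg_half : Real.arccos (-(1 / 2)) = 2 * Real.pi / 3 := by
  rw [Real.arccos_neg, ← Real.cos_pi_div_three, Real.arccos_cos]
  · ring
  · positivity
  · linarith [Real.pi_pos]

theorem angle_eq_of_inner_unitDir_eq {v a b : E}
    (h : inner ℝ (unitDir v a) (unitDir v b) = -(1 / 2)) :
    EuclideanGeometry.angle a v b = 2 * Real.pi / 3 := by
  rw [angle_eq_arccos_unitDir, h, arccos_neg_half]

theorem norm_sum_three_sq (u v w : E) :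
    ‖u + v + w‖ ^ 2 = ‖u‖ ^ 2 + ‖v‖ ^ 2 + ‖w‖ ^ 2
      + 2 * (inner ℝ u v + inner ℝ u w + inner ℝ v w) := by
  rw [norm_add_sq_real (u + v) w, norm_add_sq_real u v, inner_add_left]
  ring

/-- The squared norm of the sum is at most `3 + 2 * (-3/2) = 0`. -/
theorem sum_eq_zero_of_inner_le {u v w : E} (hu : ‖u‖ = 1) (hv : ‖v‖ = 1) (hw : ‖w‖ = 1)
    (huv : inner ℝ u v ≤ -(1 / 2)) (huw : inner ℝ u w ≤ -(1 / 2))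
    (hvw : inner ℝ v w ≤ -(1 / 2)) : u + v + w = 0 := by
  have h := norm_sum_three_sq u v w
  rw [hu, hv, hw] at h
  exact norm_eq_zero.1 (pow_eq_zero_iff two_ne_zero |>.1
    (le_antisymm (by linarith) (sq_nonneg _)))

theorem inner_eq_of_sum_eq_zero {u v w : E} (hu : ‖u‖ = 1) (hv : ‖v‖ = 1) (hw : ‖w‖ = 1)
    (h : u + v + w = 0) : inner ℝ u v = -(1 / 2) := by
  have h1 : ‖u + v‖ = 1 := by rw [eq_neg_of_add_eq_zero_left h, norm_neg, hw]
  have h2 := norm_add_sq_real u v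
  rw [h1, hu, hv] at h2
  linarith

/-- The first three vectors sum to zero, so their inner products with `x` cannot all be negative.
This bounds vertex degrees by three. -/
theorem not_four_inner_le {u v w x : E} (hu : ‖u‖ = 1) (hv : ‖v‖ = 1) (hw : ‖w‖ = 1)
    (huv : inner ℝ u v ≤ -(1 / 2)) (huw : inner ℝ u w ≤ -(1 / 2))
    (hvw : inner ℝ v w ≤ -(1 / 2)) (hux : inner ℝ u x ≤ -(1 / 2))
    (hvx : inner ℝ v x ≤ -(1 / 2)) : ¬ inner ℝ w x ≤ -(1 / 2) := by
  intro hwx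
  have h : inner ℝ (u + v + w) x = (0 : ℝ) := by
    rw [sum_eq_zero_of_inner_le hu hv hw huv huw hvw, inner_zero_left]
  rw [inner_add_left, inner_add_left] at h
  linarith

/-- Two segments enclosing an angle of less than 120 degrees can be replaced by a shorter star. -/
theorem exists_shorter_star {v a b : E} (ha : a ≠ v) (hb : b ≠ v)
    (h : -(1 / 2) < inner ℝ (unitDir v a) (unitDir v b)) :
    ∃ y, dist y v + dist y a + dist y b < dist v a + dist v b := by
  set u := unitDir v a with hu
  set w := unitDir v b with hw
  have hun : ‖u‖ = 1 := norm_unitDir ha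
  have hwn : ‖w‖ = 1 := norm_unitDir hb
  set k := ‖u + w‖ with hk
  have hk2 : k ^ 2 = 2 + 2 * inner ℝ u w := by
    rw [hk, norm_add_sq_real, hun, hwn]; ring
  -- The first-order change of length when moving along `u + w` is `k - k ^ 2`, negative exactly
  -- because the angle is below 120 degrees.
  have hk1 : 1 < k := by
    have : 1 < k ^ 2 := by linarith
    nlinarith [norm_nonneg (u + w)]
  have key : ∀ {c : E} {z : E} (t : ℝ), c ≠ v → z = unitDir v c → inner ℝ z (u + w) = k ^ 2 / 2 →
      dist (v + t • (u + w)) c ≤ dist v c - t * k ^ 2 / 2 + t ^ 2 * (k ^ 2 / (2 * dist v c)) := by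
    intro c z t hc hz hin
    have hA : 0 < dist v c := dist_pos.2 hc.symm
    have hcv : c - v = dist v c • z := by
      rw [hz, dist_comm, dist_eq_norm, norm_smul_unitDir]
    have h1 : dist (v + t • (u + w)) c ^ 2
        = dist v c ^ 2 - t * dist v c * k ^ 2 + t ^ 2 * k ^ 2 := by
      have : v + t • (u + w) - c = t • (u + w) - dist v c • z := by rw [← hcv]; abel
      rw [dist_eq_norm (v + _), this, norm_sub_sq_real, norm_smul, norm_smul, real_inner_smul_left,
        real_inner_smul_right, real_inner_comm, hin, hz, norm_unitDir hc, mul_pow, Real.norm_eq_abs,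
        Real.norm_eq_abs, sq_abs, mul_pow, sq_abs, ← hk]
      ring
    -- AM-GM avoids the square root: the distance is bounded by a quadratic polynomial in `t`.
    have h2 : dist (v + t • (u + w)) c ≤ (dist (v + t • (u + w)) c ^ 2 + dist v c ^ 2)
        / (2 * dist v c) := by
      rw [le_div_iff₀ (by positivity)]
      nlinarith [sq_nonneg (dist (v + t • (u + w)) c - dist v c)]
    refine h2.trans (le_of_eq ?_)
    rw [h1]
    field_simp
    ring
  have hiu : inner ℝ u (u + w) = k ^ 2 / 2 := by
    rw [inner_add_right, real_inner_self_eq_norm_sq, hun, hk2]; ring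
  have hiw : inner ℝ w (u + w) = k ^ 2 / 2 := by
    rw [inner_add_right, real_inner_self_eq_norm_sq, hwn, hk2, real_inner_comm]; ring
  set K := k ^ 2 / (2 * dist v a) + k ^ 2 / (2 * dist v b) with hK
  have hKpos : 0 < K := by
    have := dist_pos.2 ha.symm
    have := dist_pos.2 hb.symm
    positivity
  have hd : 0 < k ^ 2 - k := by nlinarith
  -- This `t` minimizes the resulting bound `t * (k - k ^ 2) + t ^ 2 * K` on the change of length.
  set t := (k ^ 2 - k) / (2 * K) with ht
  have htpos : 0 < t := by positivity
  have htK : t * K = (k ^ 2 - k) / 2 := by rw [ht]; field_simp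
  refine ⟨v + t • (u + w), ?_⟩
  have h1 := key t ha hu hiu
  have h2 := key t hb hw hiw
  have h3 : dist (v + t • (u + w)) v = t * k := by
    rw [dist_eq_norm, add_sub_cancel_left, norm_smul, Real.norm_of_nonneg htpos.le]
  have h4 : t ^ 2 * (k ^ 2 / (2 * dist v a)) + t ^ 2 * (k ^ 2 / (2 * dist v b))
      = t * ((k ^ 2 - k) / 2) := by rw [← mul_add, ← hK, ← htK]; ring
  nlinarith [mul_pos htpos hd]

/-- The good centres form an open set, and the complement of a finite set is dense; so the centre
can be a genuinely new Steiner point. -/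
theorem exists_shorter_star_notMem [Nontrivial E] {v a b : E} (ha : a ≠ v) (hb : b ≠ v)
    (h : -(1 / 2) < inner ℝ (unitDir v a) (unitDir v b)) {F : Set E} (hF : F.Finite) :
    ∃ y ∉ F, dist y v + dist y a + dist y b < dist v a + dist v b := by
  obtain ⟨y, hy⟩ := exists_shorter_star ha hb h
  have ho : IsOpen {y | dist y v + dist y a + dist y b < dist v a + dist v b} :=
    isOpen_lt (by fun_prop) (by fun_prop)
  obtain ⟨z, hz1, hz2⟩ := (hF.countable.dense_compl ℝ).exists_mem_open ho ⟨y, hy⟩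
  exact ⟨z, hz1, hz2⟩

/-! ### Fermat points -/

/-- Cauchy–Schwarz bounds each distance below by an affine function of `y`; the linear parts cancel
because the unit vectors sum to zero. -/
theorem dist_sum_le_of_unit_sum_eq_zero {x u v w : E} {p q r : ℝ} (hp : 0 ≤ p) (hq : 0 ≤ q)
    (hr : 0 ≤ r) (hu : ‖u‖ = 1) (hv : ‖v‖ = 1) (hw : ‖w‖ = 1) (h : u + v + w = 0) (y : E) :
    dist x (x + p • u) + dist x (x + q • v) + dist x (x + r • w) ≤
      dist y (x + p • u) + dist y (x + q • v) + dist y (x + r • w) := by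
  have key : ∀ (z : E) (t : ℝ), 0 ≤ t → ‖z‖ = 1 →
      dist x (x + t • z) = t ∧ t + inner ℝ (x - y) z ≤ dist y (x + t • z) := by
    intro z t ht hz
    constructor
    · rw [dist_eq_norm, sub_add_cancel_left, norm_neg, norm_smul, hz, Real.norm_of_nonneg ht,
        mul_one]
    · have := real_inner_le_norm (x + t • z - y) z
      rw [hz, mul_one, show x + t • z - y = (x - y) + t • z by abel, inner_add_left,
        real_inner_smul_left, real_inner_self_eq_norm_sq, hz] at this
      rw [dist_comm, dist_eq_norm, show x + t • z - y = (x - y) + t • z by abel]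
      linarith
  have hs : inner ℝ (x - y) u + inner ℝ (x - y) v + inner ℝ (x - y) w = (0 : ℝ) := by
    rw [← inner_add_right, ← inner_add_right, h, inner_zero_right]
  have := key u p hp hu
  have := key v q hq hv
  have := key w r hr hw
  linarith

/-- Equality in all three Cauchy–Schwarz bounds makes `x - y` a multiple of both `u` and `v`, which
are not parallel. -/
theorem eq_of_dist_sum_le_of_unit_sum_eq_zero {x u v w : E} {p q r : ℝ} (hp : 0 ≤ p) (hq : 0 ≤ q)
    (hr : 0 ≤ r) (hu : ‖u‖ = 1) (hv : ‖v‖ = 1) (hw : ‖w‖ = 1) (h : u + v + w = 0) {y : E}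
    (hy : dist y (x + p • u) + dist y (x + q • v) + dist y (x + r • w) ≤
      dist x (x + p • u) + dist x (x + q • v) + dist x (x + r • w)) : y = x := by
  have key : ∀ (z : E) (t : ℝ), 0 ≤ t → ‖z‖ = 1 →
      dist x (x + t • z) = t ∧ t + inner ℝ (x - y) z ≤ dist y (x + t • z) ∧
      (dist y (x + t • z) ≤ t + inner ℝ (x - y) z → x - y = (inner ℝ (x - y) z : ℝ) • z) := by
    intro z t ht hz
    have h1 := real_inner_le_norm (x + t • z - y) z
    have h2 : inner ℝ (x + t • z - y) z = t + inner ℝ (x - y) z := by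
      rw [show x + t • z - y = (x - y) + t • z by abel, inner_add_left,
        real_inner_smul_left, real_inner_self_eq_norm_sq, hz]; ring
    have h3 : dist y (x + t • z) = ‖x + t • z - y‖ := by rw [dist_comm, dist_eq_norm]
    rw [hz, mul_one] at h1
    refine ⟨?_, by linarith, fun h4 => ?_⟩
    · rw [dist_eq_norm, sub_add_cancel_left, norm_neg, norm_smul, hz, Real.norm_of_nonneg ht,
        mul_one]
    · have h5 : inner ℝ (x + t • z - y) z = ‖x + t • z - y‖ * ‖z‖ := by
        rw [hz, mul_one]; linarith
      have h6 := inner_eq_norm_mul_iff_real.1 h5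
      rw [hz, one_smul] at h6
      have h7 : ‖x + t • z - y‖ = t + inner ℝ (x - y) z := by linarith
      rw [h7, add_smul] at h6
      rw [← add_right_inj (t • z), ← h6]; abel
  have hs : inner ℝ (x - y) u + inner ℝ (x - y) v + inner ℝ (x - y) w = (0 : ℝ) := by
    rw [← inner_add_right, ← inner_add_right, h, inner_zero_right]
  obtain ⟨a1, a2, a3⟩ := key u p hp hu
  obtain ⟨b1, b2, b3⟩ := key v q hq hv
  obtain ⟨c1, c2, -⟩ := key w r hr hw
  have hA := a3 (by linarith)
  have hB := b3 (by linarith)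
  have huv := inner_eq_of_sum_eq_zero hu hv hw h
  have h1 : inner ℝ (x - y) v = inner ℝ (x - y) u * (-(1 / 2) : ℝ) := by
    conv_lhs => rw [hA, real_inner_smul_left, huv]
  have h2 : inner ℝ (x - y) u = inner ℝ (x - y) v * (-(1 / 2) : ℝ) := by
    conv_lhs => rw [hB, real_inner_smul_left, real_inner_comm u v, huv]
  have h3 : inner ℝ (x - y) u = (0 : ℝ) := by linarith
  rw [h3, zero_smul] at hA
  exact (sub_eq_zero.1 hA).symm

/-- In a Steiner star over three mutually orthogonal points, one of them a unit vector and the other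
two of norm at most one, the leg to the unit vector is longer than `1 / √3`. -/
theorem one_lt_three_mul_sq_of_orthogonal_star {s e p q u v w : E} {x y z : ℝ} (hx : 0 < x)
    (hy : 0 < y) (hz : 0 < z) (hu : ‖u‖ = 1) (hv : ‖v‖ = 1) (hw : ‖w‖ = 1) (h : u + v + w = 0)
    (he : e = s + z • u) (hp : p = s + x • v) (hq : q = s + y • w) (hen : ‖e‖ = 1)
    (hpn : ‖p‖ ≤ 1) (hqn : ‖q‖ ≤ 1) (hep : inner ℝ e p = (0 : ℝ)) (heq : inner ℝ e q = (0 : ℝ))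
    (hpq : inner ℝ p q = (0 : ℝ)) : 1 < 3 * z ^ 2 := by
  -- The squared distance of two ends, by Pythagoras and by the law of cosines at 120 degrees.
  have key : ∀ {f g a b : E} {c d : ℝ}, ‖a‖ = 1 → ‖b‖ = 1 → inner ℝ a b = (-(1 / 2) : ℝ) →
      f = s + c • a → g = s + d • b → inner ℝ f g = (0 : ℝ) →
      ‖f‖ ^ 2 + ‖g‖ ^ 2 = c ^ 2 + d ^ 2 + c * d := by
    intro f g a b c d ha hb hab hf hg hfg
    have h1 := norm_sub_sq_real f g
    have h2 : f - g = c • a - d • b := by rw [hf, hg]; abel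
    have h3 := norm_sub_sq_real (c • a) (d • b)
    rw [← h2, norm_smul, norm_smul, ha, hb, real_inner_smul_left, real_inner_smul_right, hab,
      mul_one, mul_one, Real.norm_eq_abs, Real.norm_eq_abs, sq_abs, sq_abs] at h3
    rw [hfg] at h1
    linarith
  have h1 := key hu hv (inner_eq_of_sum_eq_zero hu hv hw h) he hp hep
  have h2 := key hu hw (inner_eq_of_sum_eq_zero hu hw hv (by rw [← h]; abel)) he hq heq
  have h3 := key hv hw (inner_eq_of_sum_eq_zero hv hw hu (by rw [← h]; abel)) hp hq hpq
  have h4 : ‖p‖ ^ 2 ≤ 1 := by nlinarith [norm_nonneg p]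
  have h5 : ‖q‖ ^ 2 ≤ 1 := by nlinarith [norm_nonneg q]
  rw [hen] at h1 h2
  -- Adding `h1` and `h2` and subtracting `h3` eliminates the unknown norms of `p` and `q`.
  have h6 : (x - z) * (y - z) = 3 * z ^ 2 - 2 := by linarith
  have h7 : x ^ 2 + y ^ 2 + x * y ≤ 2 := by linarith
  -- Here `a < z < b`, so `1 ≤ (z - a) * (b - z) ≤ z * (b - z)` and `z * b ≥ 1 + z ^ 2 ≥ 2 * z`. A
  -- leg of length two contradicts `h7`.
  have key2 : ∀ {a b : ℝ}, 0 < a → 0 < b → a ≤ b → (a - z) * (b - z) ≤ -1 → 2 ≤ b := by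
    intro a b ha hb hab hm
    have h8 : a < z := by nlinarith
    have h9 : z < b := by nlinarith
    have h10 : z * 2 ≤ z * b := by nlinarith [sq_nonneg (z - 1), mul_pos ha (sub_pos.2 h9)]
    exact le_of_mul_le_mul_left h10 hz
  by_contra! hcon
  rcases le_total x y with hxy | hxy
  · nlinarith [key2 hx hy hxy (by linarith), mul_pos hx hy]
  · nlinarith [key2 hy hx hxy (by linarith), mul_pos hx hy]

end Geometry

/-! ### Finite graphs on an ambient type, and the branches of a tree -/

namespace SimpleGraph

section Ambient

variable {α : Type*} {G : SimpleGraph α} {V : Set α}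

theorem reachable_map_of_forall_adj {β : Type*} {H : SimpleGraph β} (f : α → β)
    (h : ∀ x y, G.Adj x y → H.Reachable (f x) (f y)) {x y : α} (hxy : G.Reachable x y) :
    H.Reachable (f x) (f y) := by
  obtain ⟨p⟩ := hxy
  induction p with
  | nil => exact Reachable.refl _
  | cons hadj _ ih => exact (h _ _ hadj).trans ih

/-- Folding the leaf `p` onto its neighbour `a` retracts the graph onto what remains. -/
theorem reachable_deleteEdges_of_leaf {p a x y : α} (hpa : G.Adj p a)
    (hp : ∀ w, G.Adj p w → w = a) (hx : x ≠ p) (hy : y ≠ p) (hxy : G.Reachable x y) :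
    (G.deleteEdges {s(p, a)}).Reachable x y := by
  classical
  have := reachable_map_of_forall_adj (H := G.deleteEdges {s(p, a)})
    (fun z => if z = p then a else z) ?_ hxy
  · simpa [hx, hy] using this
  intro u v huv
  by_cases hu : u = p
  · subst hu
    obtain rfl := hp v huv
    simp [huv.ne']
  · by_cases hv : v = p
    · subst hv
      obtain rfl := hp u huv.symm
      simp [hu]
    · simp only [hu, hv, if_false]
      exact Adj.reachable (deleteEdges_adj.2 ⟨huv, by simp [hu, hv]⟩)

theorem Walk.mem_of_edges_mem (hV : ∀ x y, G.Adj x y → x ∈ V ∧ y ∈ V) {x y : α}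
    (p : G.Walk x y) (hx : x ∈ V) : ∀ z ∈ p.support, z ∈ V := by
  induction p with
  | nil => simpa using hx
  | cons hadj _ ih => simpa [hx] using ih (hV _ _ hadj).2

theorem isAcyclic_of_isAcyclic_induce (hV : ∀ x y, G.Adj x y → x ∈ V ∧ y ∈ V)
    (h : (G.induce V).IsAcyclic) : G.IsAcyclic := by
  intro v c hc
  have hv : v ∈ V := by
    cases c with
    | nil => exact absurd rfl hc.ne_nil
    | cons hadj _ => exact (hV _ _ hadj).1
  have hmem := c.mem_of_edges_mem hV hv
  refine h (c.induce V hmem) ?_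
  rw [← Walk.isCycle_map_iff_of_injective (f := (Embedding.induce (G := G) V).toHom)
    (Embedding.induce (G := G) V).injective]
  have := Walk.map_induce c hmem
  rw [this]
  exact hc

theorem reachable_of_connected_induce (h : (G.induce V).Connected) {x y : α} (hx : x ∈ V)
    (hy : y ∈ V) : G.Reachable x y :=
  (h.preconnected ⟨x, hx⟩ ⟨y, hy⟩).map (Embedding.induce (G := G) V).toHom

theorem connected_induce_of_reachable (hV : ∀ x y, G.Adj x y → x ∈ V ∧ y ∈ V) {x : α}
    (hx : x ∈ V) (h : ∀ y ∈ V, G.Reachable x y) : (G.induce V).Connected := by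
  rw [connected_iff_exists_forall_reachable]
  refine ⟨⟨x, hx⟩, fun y => ?_⟩
  obtain ⟨p⟩ := h y y.2
  exact ⟨p.induce V (p.mem_of_edges_mem hV hx)⟩

theorem ncard_neighborSet_induce (hV : ∀ x y, G.Adj x y → x ∈ V ∧ y ∈ V) (v : V) :
    ((G.induce V).neighborSet v).ncard = (G.neighborSet v).ncard := by
  rw [← Set.ncard_image_of_injective _ Subtype.val_injective]
  congr 1
  ext w
  simp only [Set.mem_image, mem_neighborSet, comap_adj, Subtype.exists, exists_and_right,
    exists_eq_right]
  exact ⟨fun ⟨_, h⟩ => h, fun h => ⟨(hV _ _ h).2, h⟩⟩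

/-- The edge count of a tree, rewritten by the handshake lemma. It serves both ways: to count the
Steiner points of the old tree and to show that the new graph is a tree. -/
theorem isTree_induce_iff (V : Finset α) (hV : ∀ x y, G.Adj x y → x ∈ V ∧ y ∈ V) :
    (G.induce {x | x ∈ V}).IsTree ↔ (G.induce {x | x ∈ V}).Connected ∧
      ∑ v ∈ V, (G.neighborSet v).ncard + 2 = 2 * V.card := by
  classical
  rw [isTree_iff_connected_and_card]
  refine and_congr_right fun _ => ?_
  have h1 := (G.induce {x | x ∈ V}).sum_degrees_eq_twice_card_edges
  have h2 : ∑ v, (G.induce {x | x ∈ V}).degree v = ∑ v ∈ V, (G.neighborSet v).ncard := by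
    rw [← Finset.sum_coe_sort V]
    refine Finset.sum_congr rfl fun v _ => ?_
    rw [← ncard_neighborSet_induce (V := {x | x ∈ V}) hV v, ← card_neighborSet_eq_degree,
      ← Nat.card_eq_fintype_card, Nat.card_coe_set_eq]
  have h3 : Nat.card (G.induce {x | x ∈ V}).edgeSet
      = (G.induce {x | x ∈ V}).edgeFinset.card := by
    rw [Nat.card_eq_fintype_card, edgeFinset_card]
  have h4 : Nat.card {x | x ∈ V} = V.card := by
    simp
  rw [h3, h4]
  omega

/-- The vertices on the side of `a` when the edge between `r` and `a` is removed. -/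
def branch (G : SimpleGraph α) (r a : α) : Set α := {p | (G.deleteEdges {s(r, a)}).Reachable a p}

theorem self_mem_branch (r a : α) : a ∈ G.branch r a := Reachable.refl _

theorem disjoint_branch_swap (hG : G.IsAcyclic) {r a : α} (h : G.Adj r a) :
    Disjoint (G.branch r a) (G.branch a r) := by
  rw [Set.disjoint_left]
  intro p hp hq
  have hq' : (G.deleteEdges {s(r, a)}).Reachable r p := by
    have : (G.deleteEdges {s(a, r)}).Reachable r p := hq
    rwa [Sym2.eq_swap] at this
  exact isBridge_iff.1 (isAcyclic_iff_forall_adj_isBridge.1 hG h) (hq'.trans (Reachable.symm hp))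

theorem notMem_branch (hG : G.IsAcyclic) {r a : α} (h : G.Adj r a) : r ∉ G.branch r a :=
  fun hr => Set.disjoint_left.1 (disjoint_branch_swap hG h) hr (self_mem_branch a r)

/-- A walk from `b` without the edge `ab` never meets `a`, hence never uses the edge `ra`. -/
theorem branch_subset_branch (hG : G.IsAcyclic) {r a b : α} (hab : G.Adj a b) (hbr : b ≠ r) :
    G.branch a b ⊆ G.branch r a := by
  intro p hp
  obtain ⟨w⟩ := hp
  have hlift : ∀ {x y : α} (w : (G.deleteEdges {s(a, b)}).Walk x y), a ∉ w.support →
      (G.deleteEdges {s(r, a)}).Reachable x y := by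
    intro x y w
    induction w with
    | nil => exact fun _ => Reachable.refl _
    | @cons x y z hadj w ih =>
      intro hn
      rw [Walk.support_cons, List.mem_cons, not_or] at hn
      have hay : a ≠ y := fun h => hn.2 (h ▸ w.start_mem_support)
      refine Reachable.trans (Adj.reachable ?_) (ih hn.2)
      rw [deleteEdges_adj] at hadj ⊢
      refine ⟨hadj.1, fun h => ?_⟩
      rcases Sym2.eq_iff.1 (Set.mem_singleton_iff.1 h) with h | h
      · exact hay h.2.symm
      · exact hn.1 h.1.symm
  have ha : a ∉ w.support := by
    classical
    intro ha
    exact notMem_branch hG hab ⟨w.takeUntil a ha⟩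
  refine Reachable.trans (Adj.reachable ?_) (hlift w ha)
  rw [deleteEdges_adj]
  refine ⟨hab, fun h => ?_⟩
  rcases Sym2.eq_iff.1 (Set.mem_singleton_iff.1 h) with h | h
  · exact hab.ne h.2.symm
  · exact hbr h.2

theorem disjoint_branch (hG : G.IsAcyclic) {a b c : α} (hab : G.Adj a b) (hac : G.Adj a c)
    (hbc : b ≠ c) : Disjoint (G.branch a b) (G.branch a c) :=
  (disjoint_branch_swap hG hab).mono_right (branch_subset_branch hG hac hbc.symm)

end Ambient

end SimpleGraph

/-! ### Costs and local surgery on optimal Steiner trees -/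

section Cost

variable {n : ℕ}

theorem edgeLength_mk (x y : EuclideanSpace ℝ (Fin n)) : edgeLength s(x, y) = dist x y := rfl

theorem edgeLength_nonneg (e : Sym2 (EuclideanSpace ℝ (Fin n))) : 0 ≤ edgeLength e := by
  induction e with | h x y => exact (dist_nonneg : 0 ≤ dist x y)

theorem finite_edgeSet {G : SimpleGraph (EuclideanSpace ℝ (Fin n))}
    {V : Set (EuclideanSpace ℝ (Fin n))} (hV : V.Finite)
    (h : ∀ x y, G.Adj x y → x ∈ V ∧ y ∈ V) : G.edgeSet.Finite := by
  refine ((hV.prod hV).image fun p => s(p.1, p.2)).subset ?_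
  intro e he
  induction e with | h x y => exact ⟨(x, y), h x y he, rfl⟩

/-- Bookkeeping for surgery: remove `D`, add at most `N`. An inequality suffices, so `N` may overlap
the kept edges. -/
theorem graphCost_add_le {G H : SimpleGraph (EuclideanSpace ℝ (Fin n))}
    (hG : G.edgeSet.Finite) {D N : Finset (Sym2 (EuclideanSpace ℝ (Fin n)))}
    (hD : ↑D ⊆ G.edgeSet) (hH : ∀ e ∈ H.edgeSet, e ∈ G.edgeSet ∧ e ∉ D ∨ e ∈ N) :
    graphCost H + ∑ e ∈ D, edgeLength e ≤ graphCost G + ∑ e ∈ N, edgeLength e := by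
  classical
  have hHf : H.edgeSet.Finite :=
    (hG.union N.finite_toSet).subset fun e he => (hH e he).imp (fun h => h.1) id
  have hDs : D ⊆ hG.toFinset := fun e he => hG.mem_toFinset.2 (hD he)
  rw [graphCost, graphCost, finsum_mem_eq_finite_toFinset_sum _ hHf,
    finsum_mem_eq_finite_toFinset_sum _ hG, ← Finset.sum_sdiff hDs]
  have h1 : ∑ e ∈ hHf.toFinset, edgeLength e ≤ ∑ e ∈ (hG.toFinset \ D) ∪ N, edgeLength e := by
    refine Finset.sum_le_sum_of_subset_of_nonneg ?_ fun e _ _ => edgeLength_nonneg e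
    intro e he
    simpa using hH e (hHf.mem_toFinset.1 he)
  have h2 : ∑ e ∈ (hG.toFinset \ D) ∪ N, edgeLength e
      ≤ ∑ e ∈ hG.toFinset \ D, edgeLength e + ∑ e ∈ N, edgeLength e := by
    rw [← Finset.sum_union_inter]
    exact le_add_of_nonneg_right (Finset.sum_nonneg fun e _ => edgeLength_nonneg e)
  linarith

variable {P S : Finset (EuclideanSpace ℝ (Fin n))} {G : SimpleGraph (EuclideanSpace ℝ (Fin n))}

namespace IsSteinerTree

theorem isAcyclic (h : IsSteinerTree P S G) : G.IsAcyclic :=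
  SimpleGraph.isAcyclic_of_isAcyclic_induce (V := {x | x ∈ P ∪ S}) h.edges_mem h.isTree.isAcyclic

theorem reachable (h : IsSteinerTree P S G) {x y : EuclideanSpace ℝ (Fin n)} (hx : x ∈ P ∪ S)
    (hy : y ∈ P ∪ S) : G.Reachable x y :=
  SimpleGraph.reachable_of_connected_induce h.isTree.connected hx hy

theorem finite_edgeSet (h : IsSteinerTree P S G) : G.edgeSet.Finite :=
  _root_.finite_edgeSet (P ∪ S).finite_toSet h.edges_mem

theorem finite_neighborSet (h : IsSteinerTree P S G) (v : EuclideanSpace ℝ (Fin n)) :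
    (G.neighborSet v).Finite :=
  (P ∪ S).finite_toSet.subset fun _ hw => (h.edges_mem _ _ hw).2

end IsSteinerTree

namespace IsOptimalSteinerTree

/-- Passing to a spanning tree does not raise the cost, so competitors need only be connected. -/
theorem cost_le_of_connected (h : IsOptimalSteinerTree P S G)
    {S' : Finset (EuclideanSpace ℝ (Fin n))} {H : SimpleGraph (EuclideanSpace ℝ (Fin n))}
    (hd : Disjoint P S') (hH : ∀ x y, H.Adj x y → x ∈ P ∪ S' ∧ y ∈ P ∪ S')
    (hc : (H.induce {x | x ∈ P ∪ S'}).Connected) : graphCost G ≤ graphCost H := by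
  obtain ⟨T, hTH, hT⟩ := hc.exists_isTree_le
  set f := Function.Embedding.subtype (fun x => x ∈ {x | x ∈ P ∪ S'})
  have hle : T.map f ≤ H := by
    rw [SimpleGraph.map_le_iff_le_comap]
    exact hTH
  have hst : IsSteinerTree P S' (T.map f) := by
    refine ⟨hd, fun x y hxy => hH x y (hle hxy), ?_⟩
    have : (T.map f).induce {x | x ∈ P ∪ S'} = T := SimpleGraph.comap_map_eq f T
    rw [this]
    exact hT
  refine (h.cost_le S' _ hst).trans ?_
  have := graphCost_add_le (G := H) (H := T.map f) (D := ∅) (N := ∅)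
    (finite_edgeSet (P ∪ S').finite_toSet hH) (by simp)
    (fun e he => Or.inl ⟨SimpleGraph.edgeSet_mono hle he, by simp⟩)
  simpa using this

/-- Otherwise the edges `va` and `vb` could be exchanged for a shorter star with a new centre `y`.
-/
theorem inner_unitDir_le (h : IsOptimalSteinerTree P S G) {v a b : EuclideanSpace ℝ (Fin n)}
    (hva : G.Adj v a) (hvb : G.Adj v b) (hab : a ≠ b) :
    inner ℝ (unitDir v a) (unitDir v b) ≤ -(1 / 2) := by
  classical
  by_contra! hlt
  have : Nontrivial (EuclideanSpace ℝ (Fin n)) := ⟨⟨v, a, hva.ne⟩⟩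
  obtain ⟨y, hy, hlen⟩ := exists_shorter_star_notMem hva.ne' hvb.ne' hlt (P ∪ S).finite_toSet
  have hyV : y ∉ P ∪ S := fun hh => hy hh
  obtain ⟨hv, ha⟩ := h.edges_mem _ _ hva
  obtain ⟨-, hb⟩ := h.edges_mem _ _ hvb
  have hyv : y ≠ v := fun hh => hyV (hh ▸ hv)
  have hya : y ≠ a := fun hh => hyV (hh ▸ ha)
  have hyb : y ≠ b := fun hh => hyV (hh ▸ hb)
  set D : Finset (Sym2 (EuclideanSpace ℝ (Fin n))) := {s(v, a), s(v, b)} with hD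
  set N : Finset (Sym2 (EuclideanSpace ℝ (Fin n))) := {s(y, v), s(y, a), s(y, b)} with hN
  set H := G.deleteEdges (D : Set _) ⊔ SimpleGraph.fromEdgeSet (N : Set _) with hHdef
  have hDs : ∑ e ∈ D, edgeLength e = dist v a + dist v b := by
    rw [hD, Finset.sum_pair]
    · rfl
    · simp [hab, hvb.ne]
  have hNs : ∑ e ∈ N, edgeLength e = dist y v + dist y a + dist y b := by
    rw [hN, Finset.sum_insert, Finset.sum_pair]
    · simp only [edgeLength_mk]; ring
    · simp [hab, hyb]
    · simp [hva.ne, hvb.ne, hya, hyb]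
  have hy1 : ∀ c, s(y, c) ∈ N → y ≠ c → H.Reachable y c := fun c hc hne =>
    SimpleGraph.Adj.reachable (Or.inr ((SimpleGraph.fromEdgeSet_adj _).2 ⟨hc, hne⟩))
  have hyv' := hy1 v (by simp [hN]) hyv
  have hya' := hy1 a (by simp [hN]) hya
  have hyb' := hy1 b (by simp [hN]) hyb
  have hGH : ∀ x z, G.Adj x z → H.Reachable x z := by
    intro x z hxz
    by_cases hm : s(x, z) ∈ D
    · rw [hD, Finset.mem_insert, Finset.mem_singleton, Sym2.eq_iff, Sym2.eq_iff] at hm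
      rcases hm with (⟨rfl, rfl⟩ | ⟨rfl, rfl⟩) | (⟨rfl, rfl⟩ | ⟨rfl, rfl⟩)
      · exact hyv'.symm.trans hya'
      · exact hya'.symm.trans hyv'
      · exact hyv'.symm.trans hyb'
      · exact hyb'.symm.trans hyv'
    · exact SimpleGraph.Adj.reachable (Or.inl (SimpleGraph.deleteEdges_adj.2 ⟨hxz, hm⟩))
  have hHV : ∀ x z, H.Adj x z → x ∈ P ∪ insert y S ∧ z ∈ P ∪ insert y S := by
    have hsub : ∀ z, z ∈ P ∪ S → z ∈ P ∪ insert y S := by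
      intro z hz
      simp only [Finset.mem_union, Finset.mem_insert] at hz ⊢
      tauto
    have hyy : y ∈ P ∪ insert y S := by simp
    rintro x z (hxz | hxz)
    · have := h.edges_mem _ _ (SimpleGraph.deleteEdges_adj.1 hxz).1
      exact ⟨hsub _ this.1, hsub _ this.2⟩
    · have hm := ((SimpleGraph.fromEdgeSet_adj _).1 hxz).1
      rw [hN, Finset.mem_coe, Finset.mem_insert, Finset.mem_insert, Finset.mem_singleton,
        Sym2.eq_iff, Sym2.eq_iff, Sym2.eq_iff] at hm
      rcases hm with (⟨rfl, rfl⟩ | ⟨rfl, rfl⟩) | (⟨rfl, rfl⟩ | ⟨rfl, rfl⟩) |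
        (⟨rfl, rfl⟩ | ⟨rfl, rfl⟩)
      exacts [⟨hyy, hsub _ hv⟩, ⟨hsub _ hv, hyy⟩, ⟨hyy, hsub _ ha⟩, ⟨hsub _ ha, hyy⟩,
        ⟨hyy, hsub _ hb⟩, ⟨hsub _ hb, hyy⟩]
  have hcon : (H.induce {x | x ∈ P ∪ insert y S}).Connected := by
    refine SimpleGraph.connected_induce_of_reachable (x := y) hHV (by simp) fun z hz => ?_
    by_cases hzy : z = y
    · rw [hzy]
    · have hz' : z ∈ P ∪ S := by
        simp only [Set.mem_ofPred_eq, Finset.mem_union, Finset.mem_insert] at hz ⊢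
        tauto
      exact hyv'.trans (SimpleGraph.reachable_map_of_forall_adj id hGH (h.reachable hv hz'))
  have hdis : Disjoint P (insert y S) := by
    rw [Finset.disjoint_insert_right]
    exact ⟨fun hh => hyV (Finset.mem_union_left _ hh), h.disjoint⟩
  have h1 := h.cost_le_of_connected hdis hHV hcon
  have h2 := graphCost_add_le (G := G) (H := H) (D := D) (N := N) h.finite_edgeSet
    (by rw [hD]; intro e he; simp only [Finset.coe_insert, Finset.coe_singleton,
          Set.mem_insert_iff, Set.mem_singleton_iff] at he
        rcases he with rfl | rfl
        exacts [hva, hvb])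
    (by
      intro e he
      induction e with | h x z =>
      rcases he with he | he
      · exact Or.inl (SimpleGraph.deleteEdges_adj.1 he)
      · exact Or.inr ((SimpleGraph.fromEdgeSet_adj _).1 he).1)
  linarith

/-- If the only neighbour of the vertex `p` is `a`, then no other vertex is closer to `p`. -/
theorem dist_le_of_leaf (h : IsOptimalSteinerTree P S G) {p a r : EuclideanSpace ℝ (Fin n)}
    (hpa : G.Adj p a) (hp : ∀ w, G.Adj p w → w = a) (hr : r ∈ P ∪ S) (hrp : r ≠ p) :
    dist p a ≤ dist p r := by
  classical
  by_contra! hlt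
  obtain ⟨hpV, haV⟩ := h.edges_mem _ _ hpa
  set H := G.deleteEdges (({s(p, a)} : Finset _) : Set _) ⊔
    SimpleGraph.fromEdgeSet ((({s(p, r)} : Finset _)) : Set _) with hHdef
  have hpr : H.Adj p r := Or.inr ((SimpleGraph.fromEdgeSet_adj _).2 ⟨by simp, hrp.symm⟩)
  have hle : G.deleteEdges {s(p, a)} ≤ H := by
    intro x z hxz
    exact Or.inl (by simpa using hxz)
  have hra : H.Reachable r a :=
    (SimpleGraph.reachable_deleteEdges_of_leaf hpa hp hrp hpa.ne' (h.reachable hr haV)).mono hle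
  have hGH : ∀ x z, G.Adj x z → H.Reachable x z := by
    intro x z hxz
    by_cases hm : s(x, z) = s(p, a)
    · rcases Sym2.eq_iff.1 hm with ⟨rfl, rfl⟩ | ⟨rfl, rfl⟩
      · exact hpr.reachable.trans hra
      · exact (hpr.reachable.trans hra).symm
    · exact SimpleGraph.Adj.reachable (hle (SimpleGraph.deleteEdges_adj.2 ⟨hxz, hm⟩))
  have hHV : ∀ x z, H.Adj x z → x ∈ P ∪ S ∧ z ∈ P ∪ S := by
    rintro x z (hxz | hxz)
    · exact h.edges_mem _ _ (SimpleGraph.deleteEdges_adj.1 hxz).1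
    · have hm := ((SimpleGraph.fromEdgeSet_adj _).1 hxz).1
      rw [Finset.mem_coe, Finset.mem_singleton] at hm
      rcases Sym2.eq_iff.1 hm with ⟨rfl, rfl⟩ | ⟨rfl, rfl⟩
      exacts [⟨hpV, hr⟩, ⟨hr, hpV⟩]
  have h1 := h.cost_le_of_connected h.disjoint hHV
    (SimpleGraph.connected_induce_of_reachable (x := p) hHV hpV fun z hz =>
      SimpleGraph.reachable_map_of_forall_adj id hGH (h.reachable hpV hz))
  have h2 := graphCost_add_le (G := G) (H := H) (D := {s(p, a)}) (N := {s(p, r)}) h.finite_edgeSet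
    (by simpa using hpa)
    (by
      intro e he
      induction e with | h x z =>
      rcases he with he | he
      · exact Or.inl (SimpleGraph.deleteEdges_adj.1 he)
      · exact Or.inr ((SimpleGraph.fromEdgeSet_adj _).1 he).1)
  rw [Finset.sum_singleton, Finset.sum_singleton, edgeLength_mk, edgeLength_mk] at h2
  linarith

theorem ncard_neighborSet_ne_one (h : IsOptimalSteinerTree P S G)
    {s : EuclideanSpace ℝ (Fin n)} (hs : s ∈ S) (hne : P.Nonempty) :
    (G.neighborSet s).ncard ≠ 1 := by
  classical
  intro hcard
  obtain ⟨a, ha⟩ := Set.ncard_eq_one.1 hcard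
  have hsa : G.Adj s a := by
    rw [← SimpleGraph.mem_neighborSet, ha]; rfl
  have hsn : ∀ w, G.Adj s w → w = a := by
    intro w hw
    rw [← SimpleGraph.mem_neighborSet, ha] at hw
    exact hw
  obtain ⟨p, hp⟩ := hne
  have hsP : s ∉ P := fun hh => Finset.disjoint_left.1 h.disjoint hh hs
  have hps : p ≠ s := fun hh => hsP (hh ▸ hp)
  have hmem : ∀ z, z ∈ P ∪ S.erase s ↔ z ≠ s ∧ z ∈ P ∪ S := by
    intro z
    simp only [Finset.mem_union, Finset.mem_erase]
    constructor
    · rintro (hz | ⟨h1, h2⟩)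
      exacts [⟨fun hh => hsP (hh ▸ hz), Or.inl hz⟩, ⟨h1, Or.inr h2⟩]
    · rintro ⟨h1, h2 | h2⟩
      exacts [Or.inl h2, Or.inr ⟨h1, h2⟩]
  have hHV : ∀ x z, (G.deleteEdges {s(s, a)}).Adj x z →
      x ∈ P ∪ S.erase s ∧ z ∈ P ∪ S.erase s := by
    intro x z hxz
    obtain ⟨h1, h2⟩ := SimpleGraph.deleteEdges_adj.1 hxz
    obtain ⟨hx, hz⟩ := h.edges_mem _ _ h1
    rw [hmem, hmem]
    refine ⟨⟨?_, hx⟩, ⟨?_, hz⟩⟩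
    · rintro rfl
      exact h2 (by rw [hsn z h1]; rfl)
    · rintro rfl
      exact h2 (by rw [hsn x h1.symm, Sym2.eq_swap]; rfl)
  have hpV : p ∈ P ∪ S := Finset.mem_union_left _ hp
  have h1 := h.cost_le_of_connected (h.disjoint.mono_right (Finset.erase_subset s S)) hHV
    (SimpleGraph.connected_induce_of_reachable (x := p) hHV (Finset.mem_union_left _ hp)
      fun z hz => SimpleGraph.reachable_deleteEdges_of_leaf hsa hsn hps ((hmem z).1 hz).1
        (h.reachable hpV ((hmem z).1 hz).2))
  have h2 := graphCost_add_le (G := G) (H := G.deleteEdges {s(s, a)}) (D := {s(s, a)}) (N := ∅)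
    h.finite_edgeSet (by simpa using hsa)
    (by
      intro e he
      induction e with | h x z =>
      exact Or.inl (by simpa using SimpleGraph.deleteEdges_adj.1 he))
  rw [Finset.sum_singleton, Finset.sum_empty, edgeLength_mk] at h2
  linarith [dist_pos.2 hsa.ne]

theorem ncard_neighborSet_eq_three (h : IsOptimalSteinerTree P S G)
    {s : EuclideanSpace ℝ (Fin n)} (hs : s ∈ S) (hne : P.Nonempty) :
    (G.neighborSet s).ncard = 3 := by
  have hfin := h.finite_neighborSet s
  have h0 : (G.neighborSet s).ncard ≠ 0 := by
    intro h0
    rw [Set.ncard_eq_zero hfin] at h0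
    obtain ⟨p, hp⟩ := hne
    have hsp : s ≠ p := fun hh => Finset.disjoint_left.1 h.disjoint (hh ▸ hp) hs
    obtain ⟨a, ha⟩ := (h.reachable (Finset.mem_union_right _ hs)
      (Finset.mem_union_left _ hp)).nonempty_neighborSet_left hsp
    rw [h0] at ha
    exact ha
  have h1 := h.ncard_neighborSet_ne_one hs hne
  have h2 := h.no_subdivision s hs
  by_contra h3
  obtain ⟨t, ht, htc⟩ := Set.exists_subset_card_eq (s := G.neighborSet s) (n := 4) (by omega)
  obtain ⟨a, b, c, e, hab, hac, hae, hbc, hbe, hce, rfl⟩ := Set.ncard_eq_four.1 htc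
  have ha : G.Adj s a := ht (by simp)
  have hb : G.Adj s b := ht (by simp)
  have hc : G.Adj s c := ht (by simp)
  have he : G.Adj s e := ht (by simp)
  exact not_four_inner_le (norm_unitDir ha.ne') (norm_unitDir hb.ne') (norm_unitDir hc.ne')
    (h.inner_unitDir_le ha hb hab) (h.inner_unitDir_le ha hc hac) (h.inner_unitDir_le hb hc hbc)
    (h.inner_unitDir_le ha he hae) (h.inner_unitDir_le hb he hbe) (h.inner_unitDir_le hc he hce)

/-- At a Steiner point, the unit vectors to the three neighbours sum to zero. -/
theorem exists_neighbors (h : IsOptimalSteinerTree P S G) {s r : EuclideanSpace ℝ (Fin n)}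
    (hs : s ∈ S) (hne : P.Nonempty) (hr : G.Adj s r) :
    ∃ a b, G.Adj s a ∧ G.Adj s b ∧ a ≠ r ∧ b ≠ r ∧ a ≠ b ∧ (∀ w, G.Adj s w → w = r ∨ w = a ∨ w = b)
      ∧ unitDir s r + unitDir s a + unitDir s b = 0 := by
  have key : ∀ {a b : EuclideanSpace ℝ (Fin n)}, a ≠ r → b ≠ r → a ≠ b →
      G.neighborSet s = {r, a, b} →
      ∃ a b, G.Adj s a ∧ G.Adj s b ∧ a ≠ r ∧ b ≠ r ∧ a ≠ b ∧
      (∀ w, G.Adj s w → w = r ∨ w = a ∨ w = b) ∧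
      unitDir s r + unitDir s a + unitDir s b = 0 := by
    intro a b har hbr hab hN
    have hm : ∀ w, G.Adj s w ↔ w = r ∨ w = a ∨ w = b := by
      intro w
      rw [← SimpleGraph.mem_neighborSet, hN]
      simp
    have ha : G.Adj s a := (hm a).2 (by simp)
    have hb : G.Adj s b := (hm b).2 (by simp)
    exact ⟨a, b, ha, hb, har, hbr, hab, fun w hw => (hm w).1 hw,
      sum_eq_zero_of_inner_le (norm_unitDir hr.ne') (norm_unitDir ha.ne') (norm_unitDir hb.ne')
        (h.inner_unitDir_le hr ha har.symm) (h.inner_unitDir_le hr hb hbr.symm)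
        (h.inner_unitDir_le ha hb hab)⟩
  obtain ⟨x, y, z, hxy, hxz, hyz, hN⟩ := Set.ncard_eq_three.1 (h.ncard_neighborSet_eq_three hs hne)
  have hrm : r ∈ ({x, y, z} : Set _) := hN ▸ hr
  rcases hrm with rfl | rfl | rfl
  · exact key hxy.symm hxz.symm hyz hN
  · exact key hxy hyz.symm hxz (by rw [hN, Set.insert_comm])
  · exact key hxz hyz hxy (by rw [hN, Set.pair_comm y, Set.insert_comm])

end IsOptimalSteinerTree

end Cost

/-! ### Optimal Steiner trees of the regular simplex -/

section Simplex

variable {d : ℕ}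

theorem mem_regularSimplex {v : EuclideanSpace ℝ (Fin d)} :
    v ∈ regularSimplex d ↔ ∃ i, simplexVertex d i = v := by
  simp [regularSimplex]

theorem simplexVertex_mem (i : Fin d) : simplexVertex d i ∈ regularSimplex d :=
  mem_regularSimplex.2 ⟨i, rfl⟩

theorem simplexVertex_apply (i k : Fin d) : simplexVertex d i k = if k = i then 1 else 0 := by
  simp [simplexVertex]

theorem simplexVertex_injective : Function.Injective (simplexVertex d) := by
  intro i j hij
  have := congrArg (fun v : EuclideanSpace ℝ (Fin d) => v i) hij
  simp only [simplexVertex_apply] at this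
  by_contra hne
  simp [hne] at this

theorem card_regularSimplex : (regularSimplex d).card = d := by
  classical
  rw [regularSimplex, Finset.card_image_of_injective _ simplexVertex_injective]
  simp

theorem norm_simplexVertex (i : Fin d) : ‖simplexVertex d i‖ = 1 := by
  simp [simplexVertex]

theorem inner_simplexVertex (i : Fin d) (v : EuclideanSpace ℝ (Fin d)) :
    inner ℝ (simplexVertex d i) v = v i := by
  simp [simplexVertex, EuclideanSpace.inner_single_left]

/-- `p` is a convex combination of those vertices of the regular simplex that lie in `A`. -/
structure IsHullPoint (A : Set (EuclideanSpace ℝ (Fin d))) (p : EuclideanSpace ℝ (Fin d)) :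
    Prop where
  nonneg : ∀ k, 0 ≤ p k
  sum_eq_one : ∑ k, p k = 1
  eq_zero : ∀ k, simplexVertex d k ∉ A → p k = 0

namespace IsHullPoint

variable {A B : Set (EuclideanSpace ℝ (Fin d))} {p q : EuclideanSpace ℝ (Fin d)}

theorem simplexVertex {i : Fin d} (hi : simplexVertex d i ∈ A) :
    IsHullPoint A (simplexVertex d i) where
  nonneg k := by rw [simplexVertex_apply]; split_ifs <;> norm_num
  sum_eq_one := by simp [simplexVertex_apply]
  eq_zero k hk := by
    rw [simplexVertex_apply, if_neg]
    rintro rfl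
    exact hk hi

theorem mono (h : IsHullPoint A p) (hAB : A ⊆ B) : IsHullPoint B p :=
  ⟨h.nonneg, h.sum_eq_one, fun k hk => h.eq_zero k fun hA => hk (hAB hA)⟩

theorem combo (hp : IsHullPoint A p) (hq : IsHullPoint A q) {s t : ℝ} (hs : 0 ≤ s) (ht : 0 ≤ t)
    (hst : s + t = 1) : IsHullPoint A (s • p + t • q) where
  nonneg k := by
    have := hp.nonneg k
    have := hq.nonneg k
    simp only [PiLp.add_apply, PiLp.smul_apply, smul_eq_mul]
    positivity
  sum_eq_one := by
    simp only [PiLp.add_apply, PiLp.smul_apply, smul_eq_mul]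
    rw [Finset.sum_add_distrib, ← Finset.mul_sum, ← Finset.mul_sum, hp.sum_eq_one, hq.sum_eq_one,
      mul_one, mul_one, hst]
  eq_zero k hk := by simp [hp.eq_zero k hk, hq.eq_zero k hk]

theorem le_one (hp : IsHullPoint A p) (k : Fin d) : p k ≤ 1 := by
  rw [← hp.sum_eq_one]
  exact Finset.single_le_sum (fun j _ => hp.nonneg j) (Finset.mem_univ k)

theorem norm_le_one (hp : IsHullPoint A p) : ‖p‖ ≤ 1 := by
  rw [EuclideanSpace.norm_eq]
  refine Real.sqrt_le_one.2 (le_of_le_of_eq ?_ hp.sum_eq_one)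
  refine Finset.sum_le_sum fun k _ => ?_
  rw [Real.norm_eq_abs, sq_abs, sq]
  exact mul_le_of_le_one_left (hp.nonneg k) (hp.le_one k)

theorem inner_eq_zero (hp : IsHullPoint A p) (hq : IsHullPoint B q) (h : Disjoint A B) :
    inner ℝ p q = (0 : ℝ) := by
  rw [PiLp.inner_apply]
  refine Finset.sum_eq_zero fun k _ => ?_
  by_cases hk : _root_.simplexVertex d k ∈ A
  · rw [hq.eq_zero k (Set.disjoint_left.1 h hk), inner_zero_right]
  · rw [hp.eq_zero k hk, inner_zero_left]

theorem inner_sub_simplexVertex_nonneg (hp : IsHullPoint A p) (hq : IsHullPoint B q) (i : Fin d) :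
    0 ≤ inner ℝ (p - _root_.simplexVertex d i) (q - _root_.simplexVertex d i) := by
  have h1 : p i * q i ≤ inner ℝ p q := by
    rw [PiLp.inner_apply]
    have : p i * q i = inner ℝ (p i) (q i) := by simp [mul_comm]
    rw [this]
    refine Finset.single_le_sum (f := fun k => inner ℝ (p k) (q k)) (fun k _ => ?_)
      (Finset.mem_univ i)
    simpa using mul_nonneg (hq.nonneg k) (hp.nonneg k)
  rw [inner_sub_left, inner_sub_right, inner_sub_right, real_inner_comm (_root_.simplexVertex d i) p,
    inner_simplexVertex, inner_simplexVertex, inner_simplexVertex, simplexVertex_apply, if_pos rfl]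
  nlinarith [mul_nonneg (sub_nonneg.2 (hp.le_one i)) (sub_nonneg.2 (hq.le_one i))]

end IsHullPoint

/-! ### Structure of optimal trees of the simplex: collapsed branches, leaves, long terminal edges
-/

variable {S : Finset (EuclideanSpace ℝ (Fin d))} {G : SimpleGraph (EuclideanSpace ℝ (Fin d))}

namespace IsOptimalSteinerTree

/-- Every branch of an optimal Steiner tree can be replaced by a single edge that ends in a convex
combination of the terminals of that branch. -/
theorem exists_hullPoint (h : IsOptimalSteinerTree (regularSimplex d) S G)
    {r a : EuclideanSpace ℝ (Fin d)} (hra : G.Adj r a) :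
    ∃ p, ∃ x : ℝ, 0 < x ∧ IsHullPoint (G.branch r a) p ∧ p = r + x • unitDir r a := by
  have hfin : ∀ r a, (G.branch r a ∩ {x | x ∈ regularSimplex d ∪ S}).Finite := fun r a =>
    (regularSimplex d ∪ S).finite_toSet.subset Set.inter_subset_right
  induction hm : (G.branch r a ∩ {x | x ∈ regularSimplex d ∪ S}).ncard using Nat.strong_induction_on
    generalizing r a with
  | _ m ih =>
  obtain ⟨hr, ha⟩ := h.edges_mem _ _ hra
  have hpos : 0 < ‖a - r‖ := norm_pos_iff.2 (sub_ne_zero.2 hra.ne')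
  rcases Finset.mem_union.1 ha with haP | haS
  · obtain ⟨i, rfl⟩ := mem_regularSimplex.1 haP
    exact ⟨_, _, hpos, IsHullPoint.simplexVertex (SimpleGraph.self_mem_branch _ _), by
      rw [norm_smul_unitDir, add_sub_cancel]⟩
  · have hne : (regularSimplex d).Nonempty := by
      rcases d with _ | d
      · exact absurd (Subsingleton.elim r a) hra.ne
      · exact ⟨_, simplexVertex_mem 0⟩
    obtain ⟨b, c, hab, hac, hbr, hcr, -, -, hsum⟩ := h.exists_neighbors haS hne hra.symm
    have hrec : ∀ b, G.Adj a b → b ≠ r →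
        ∃ p, ∃ x : ℝ, 0 < x ∧ IsHullPoint (G.branch r a) p ∧ p = a + x • unitDir a b := by
      intro b hab hbr
      have hsub := SimpleGraph.branch_subset_branch h.isAcyclic hab hbr
      obtain ⟨p, x, hx, hp, hpx⟩ := ih _ (by
        rw [← hm]
        refine Set.ncard_lt_ncard ((Set.ssubset_iff_of_subset
          (Set.inter_subset_inter_left _ hsub)).2 ⟨a, ⟨SimpleGraph.self_mem_branch _ _, ha⟩, ?_⟩)
          (hfin r a)
        exact fun hh => SimpleGraph.notMem_branch h.isAcyclic hab hh.1) hab rfl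
      exact ⟨p, x, hx, hp.mono hsub, hpx⟩
    obtain ⟨p, x, hx, hp, hpx⟩ := hrec b hab hbr
    obtain ⟨q, y, hy, hq, hqy⟩ := hrec c hac hcr
    -- At 120 degrees the two outgoing directions add up to the incoming one.
    have hbc : unitDir a b + unitDir a c = unitDir r a := by
      rw [unitDir_swap a r]
      exact eq_neg_of_add_eq_zero_right (by rw [← hsum]; abel)
    -- The weights give both outgoing directions the coefficient `x * y / (x + y)`: this is where
    -- the ray from `r` through `a` meets the segment `pq`.
    refine ⟨(y / (x + y)) • p + (x / (x + y)) • q, ‖a - r‖ + x * y / (x + y), by positivity,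
      hp.combo hq (by positivity) (by positivity) (by field_simp; ring), ?_⟩
    rw [add_smul, norm_smul_unitDir, ← hbc, hpx, hqy]
    have h1 : y / (x + y) + x / (x + y) = 1 := by field_simp; ring
    calc (y / (x + y)) • (a + x • unitDir a b) + (x / (x + y)) • (a + y • unitDir a c)
        = (y / (x + y) + x / (x + y)) • a
          + (x * y / (x + y)) • (unitDir a b + unitDir a c) := by
          simp only [smul_add, add_smul, smul_smul]
          rw [show y / (x + y) * x = x * y / (x + y) by ring,
            show x / (x + y) * y = x * y / (x + y) by ring]
          abel
      _ = _ := by rw [h1, one_smul]; abel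

/-- Seen from a terminal, any two points of the simplex enclose at most 90 degrees, in particular
the ends of two collapsed branches; this contradicts the 120 degree bound. -/
theorem existsUnique_neighbor (h : IsOptimalSteinerTree (regularSimplex d) S G) (hd : 2 ≤ d)
    (i : Fin d) : ∃! v, G.Adj (simplexVertex d i) v := by
  have : Nontrivial (Fin d) := Fin.nontrivial_iff_two_le.2 hd
  obtain ⟨j, hj⟩ := exists_ne i
  obtain ⟨a, ha⟩ := (h.reachable (Finset.mem_union_left _ (simplexVertex_mem i))
    (Finset.mem_union_left _ (simplexVertex_mem j))).nonempty_neighborSet_left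
    fun hh => hj (simplexVertex_injective hh).symm
  refine ⟨a, ha, fun b hb => ?_⟩
  by_contra hba
  have h1 := h.inner_unitDir_le hb ha hba
  obtain ⟨p, x, hx, hp, hpx⟩ := h.exists_hullPoint hb
  obtain ⟨q, y, hy, hq, hqy⟩ := h.exists_hullPoint ha
  have h2 := hp.inner_sub_simplexVertex_nonneg hq i
  rw [hpx, hqy, add_sub_cancel_left, add_sub_cancel_left, real_inner_smul_left,
    real_inner_smul_right] at h2
  nlinarith [mul_pos hx hy]

/-- Two adjacent terminals, both leaves, would be cut off from a third terminal. -/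
theorem neighbor_mem_steiner (h : IsOptimalSteinerTree (regularSimplex d) S G) (hd : 3 ≤ d)
    {i : Fin d} {v : EuclideanSpace ℝ (Fin d)} (hv : G.Adj (simplexVertex d i) v) : v ∈ S := by
  classical
  refine (Finset.mem_union.1 (h.edges_mem _ _ hv).2).resolve_left fun hvP => ?_
  obtain ⟨j, rfl⟩ := mem_regularSimplex.1 hvP
  obtain ⟨k, hk⟩ : ∃ k : Fin d, k ∉ ({i, j} : Finset (Fin d)) := by
    by_contra! hall
    have h1 : (Finset.univ : Finset (Fin d)).card ≤ ({i, j} : Finset (Fin d)).card :=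
      Finset.card_le_card fun k _ => hall k
    have h2 := Finset.card_le_two (a := i) (b := j)
    rw [Finset.card_univ, Fintype.card_fin] at h1
    omega
  have hki : simplexVertex d k ≠ simplexVertex d i := fun hh =>
    hk (by simp [simplexVertex_injective hh])
  have hkj : simplexVertex d k ≠ simplexVertex d j := fun hh =>
    hk (by simp [simplexVertex_injective hh])
  have huj : ∀ w, G.Adj (simplexVertex d j) w → w = simplexVertex d i := fun w hw =>
    (h.existsUnique_neighbor (by omega) j).unique hw hv.symm
  have hui : ∀ w, G.Adj (simplexVertex d i) w → w = simplexVertex d j := fun w hw =>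
    (h.existsUnique_neighbor (by omega) i).unique hw hv
  have hr := SimpleGraph.reachable_deleteEdges_of_leaf hv hui hv.ne' hki
    (h.reachable (Finset.mem_union_left _ (simplexVertex_mem j))
      (Finset.mem_union_left _ (simplexVertex_mem k)))
  obtain ⟨w, hw⟩ := hr.nonempty_neighborSet_left hkj.symm
  have hw' := SimpleGraph.deleteEdges_adj.1 hw
  exact hw'.2 (by rw [huj w hw'.1, Sym2.eq_swap]; rfl)

theorem one_lt_three_mul_dist_sq (h : IsOptimalSteinerTree (regularSimplex d) S G) (hd : 3 ≤ d)
    {i : Fin d} {s : EuclideanSpace ℝ (Fin d)} (hs : G.Adj (simplexVertex d i) s) :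
    1 < 3 * dist (simplexVertex d i) s ^ 2 := by
  have hsS := h.neighbor_mem_steiner hd hs
  obtain ⟨a, b, ha, hb, har, hbr, hab, -, hsum⟩ :=
    h.exists_neighbors hsS ⟨_, simplexVertex_mem i⟩ hs.symm
  obtain ⟨p, x, hx, hp, hpx⟩ := h.exists_hullPoint ha
  obtain ⟨q, y, hy, hq, hqy⟩ := h.exists_hullPoint hb
  have he := IsHullPoint.simplexVertex (SimpleGraph.self_mem_branch (G := G) s (simplexVertex d i))
  rw [dist_eq_norm]
  exact one_lt_three_mul_sq_of_orthogonal_star hx hy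
    (norm_pos_iff.2 (sub_ne_zero.2 hs.ne)) (norm_unitDir hs.ne) (norm_unitDir ha.ne')
    (norm_unitDir hb.ne') hsum (by rw [norm_smul_unitDir, add_sub_cancel]) hpx hqy
    (norm_simplexVertex i) hp.norm_le_one hq.norm_le_one
    (he.inner_eq_zero hp (SimpleGraph.disjoint_branch h.isAcyclic hs.symm ha har.symm))
    (he.inner_eq_zero hq (SimpleGraph.disjoint_branch h.isAcyclic hs.symm hb hbr.symm))
    (hp.inner_eq_zero hq (SimpleGraph.disjoint_branch h.isAcyclic ha hb hab))

/-- Degrees one at terminals and three at Steiner points give `d + 3 * |S| + 2 = 2 * (d + |S|)`. -/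
theorem card_steiner (h : IsOptimalSteinerTree (regularSimplex d) S G) (hd : 3 ≤ d) :
    S.card + 2 = d := by
  classical
  have hV := ((SimpleGraph.isTree_induce_iff (regularSimplex d ∪ S) h.edges_mem).1 h.isTree).2
  have h1 : ∑ v ∈ regularSimplex d, (G.neighborSet v).ncard = d := by
    rw [Finset.sum_congr rfl (g := fun _ => 1), Finset.sum_const, card_regularSimplex, smul_eq_mul,
      mul_one]
    intro v hv
    obtain ⟨i, rfl⟩ := mem_regularSimplex.1 hv
    obtain ⟨a, ha, hu⟩ := h.existsUnique_neighbor (by omega) i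
    exact Set.ncard_eq_one.2 ⟨a, Set.ext fun w => ⟨hu w, fun hw => by rw [hw]; exact ha⟩⟩
  have h2 : ∑ v ∈ S, (G.neighborSet v).ncard = S.card * 3 := by
    rw [Finset.sum_congr rfl (g := fun _ => 3), Finset.sum_const, smul_eq_mul]
    exact fun v hv => h.ncard_neighborSet_eq_three hv ⟨_, simplexVertex_mem ⟨0, by omega⟩⟩
  rw [Finset.sum_union h.disjoint, h1, h2, Finset.card_union_of_disjoint h.disjoint,
    card_regularSimplex] at hV
  omega

end IsOptimalSteinerTree

end Simplex

/-! ### Splitting points -/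

section Split

variable {d : ℕ}

theorem splitPoint_apply (x : EuclideanSpace ℝ (Fin d)) (k : Fin (2 * d)) :
    splitPoint x k = x ⟨k.val / 2, by have := k.isLt; omega⟩ / 2 := rfl

theorem splitPoint_add (x y : EuclideanSpace ℝ (Fin d)) :
    splitPoint (x + y) = splitPoint x + splitPoint y := by
  ext k; simp [splitPoint_apply, add_div]

theorem splitPoint_smul (c : ℝ) (x : EuclideanSpace ℝ (Fin d)) :
    splitPoint (c • x) = c • splitPoint x := by
  ext k; simp [splitPoint_apply, mul_div_assoc]

theorem sum_fin_two_mul (f : Fin (2 * d) → ℝ) :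
    ∑ k, f k = ∑ i : Fin d, (f ⟨2 * i.val, by have := i.isLt; omega⟩
      + f ⟨2 * i.val + 1, by have := i.isLt; omega⟩) := by
  rw [← Finset.sum_fiberwise (s := Finset.univ)
    (g := fun k : Fin (2 * d) => (⟨k.val / 2, by have := k.isLt; omega⟩ : Fin d)) (f := f)]
  refine Finset.sum_congr rfl fun i _ => ?_
  rw [← Finset.sum_pair (f := f)]
  · refine Finset.sum_congr ?_ fun _ _ => rfl
    ext k
    simp only [Finset.mem_filter, Finset.mem_univ, true_and, Finset.mem_insert,
      Finset.mem_singleton, Fin.ext_iff]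
    omega
  · simp [Fin.ext_iff]

theorem inner_splitPoint (x y : EuclideanSpace ℝ (Fin d)) :
    inner ℝ (splitPoint x) (splitPoint y) = (inner ℝ x y : ℝ) / 2 := by
  rw [PiLp.inner_apply, PiLp.inner_apply, sum_fin_two_mul, Finset.sum_div]
  refine Finset.sum_congr rfl fun i _ => ?_
  have h1 : (⟨2 * i.val / 2, by have := i.isLt; omega⟩ : Fin d) = i := Fin.ext (by simp)
  have h2 : (⟨(2 * i.val + 1) / 2, by have := i.isLt; omega⟩ : Fin d) = i :=
    Fin.ext (by simp only; omega)
  simp only [splitPoint_apply, h1, h2, RCLike.inner_apply, conj_trivial]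
  ring

theorem norm_sqrt_two_smul_splitPoint (x : EuclideanSpace ℝ (Fin d)) :
    ‖√2 • splitPoint x‖ = ‖x‖ := by
  rw [← sq_eq_sq₀ (norm_nonneg _) (norm_nonneg _), ← real_inner_self_eq_norm_sq,
    ← real_inner_self_eq_norm_sq, real_inner_smul_left, real_inner_smul_right, inner_splitPoint]
  linear_combination (inner ℝ x x / 2) * Real.mul_self_sqrt (zero_le_two (α := ℝ))

theorem splitPoint_injective : Function.Injective (splitPoint (d := d)) := by
  intro x y hxy
  ext i
  have := congrArg (fun v : EuclideanSpace ℝ (Fin (2 * d)) =>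
    v ⟨2 * i.val, by have := i.isLt; omega⟩) hxy
  simp only [splitPoint_apply] at this
  have h1 : (⟨2 * i.val / 2, by have := i.isLt; omega⟩ : Fin d) = i := Fin.ext (by simp)
  rw [h1] at this
  linarith

theorem leftTerminal_apply (i : Fin d) (k : Fin (2 * d)) :
    leftTerminal i k = if k.val = 2 * i.val then 1 else 0 := by
  simp [leftTerminal, simplexVertex_apply, Fin.ext_iff]

theorem rightTerminal_apply (i : Fin d) (k : Fin (2 * d)) :
    rightTerminal i k = if k.val = 2 * i.val + 1 then 1 else 0 := by
  simp [rightTerminal, simplexVertex_apply, Fin.ext_iff]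

theorem leftTerminal_injective : Function.Injective (leftTerminal (d := d)) := by
  intro i j hij
  have := simplexVertex_injective hij
  simp only [Fin.mk.injEq] at this
  exact Fin.ext (by omega)

theorem rightTerminal_injective : Function.Injective (rightTerminal (d := d)) := by
  intro i j hij
  have := simplexVertex_injective hij
  simp only [Fin.mk.injEq] at this
  exact Fin.ext (by omega)

theorem leftTerminal_ne_rightTerminal (i j : Fin d) : leftTerminal i ≠ rightTerminal j := by
  intro hij
  have := simplexVertex_injective hij
  simp only [Fin.mk.injEq] at this
  omega

theorem mem_regularSimplex_two_mul {v : EuclideanSpace ℝ (Fin (2 * d))} :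
    v ∈ regularSimplex (2 * d) ↔ ∃ i : Fin d, v = leftTerminal i ∨ v = rightTerminal i := by
  rw [mem_regularSimplex]
  constructor
  · rintro ⟨k, rfl⟩
    refine ⟨⟨k.val / 2, by have := k.isLt; omega⟩, ?_⟩
    rcases Nat.even_or_odd' k.val with ⟨c, hc | hc⟩
    · exact Or.inl (congrArg _ (Fin.ext (by simp only; omega)))
    · exact Or.inr (congrArg _ (Fin.ext (by simp only; omega)))
  · rintro ⟨i, rfl | rfl⟩
    exacts [⟨_, rfl⟩, ⟨_, rfl⟩]

/-- The two coordinates of a pair agree in a split point but not in a terminal. -/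
theorem splitPoint_ne_leftTerminal (x : EuclideanSpace ℝ (Fin d)) (i : Fin d) :
    splitPoint x ≠ leftTerminal i := by
  intro h
  have h0 := congrArg (fun v : EuclideanSpace ℝ (Fin (2 * d)) =>
    v ⟨2 * i.val, by have := i.isLt; omega⟩) h
  have h1 := congrArg (fun v : EuclideanSpace ℝ (Fin (2 * d)) =>
    v ⟨2 * i.val + 1, by have := i.isLt; omega⟩) h
  have h2 : (⟨(2 * i.val + 1) / 2, by have := i.isLt; omega⟩ : Fin d)
    = ⟨2 * i.val / 2, by have := i.isLt; omega⟩ := Fin.ext (by simp only; omega)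
  simp only [splitPoint_apply, leftTerminal_apply, h2] at h0 h1
  rw [h0] at h1
  simp at h1

theorem splitPoint_ne_rightTerminal (x : EuclideanSpace ℝ (Fin d)) (i : Fin d) :
    splitPoint x ≠ rightTerminal i := by
  intro h
  have h0 := congrArg (fun v : EuclideanSpace ℝ (Fin (2 * d)) =>
    v ⟨2 * i.val, by have := i.isLt; omega⟩) h
  have h1 := congrArg (fun v : EuclideanSpace ℝ (Fin (2 * d)) =>
    v ⟨2 * i.val + 1, by have := i.isLt; omega⟩) h
  have h2 : (⟨(2 * i.val + 1) / 2, by have := i.isLt; omega⟩ : Fin d)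
    = ⟨2 * i.val / 2, by have := i.isLt; omega⟩ := Fin.ext (by simp only; omega)
  simp only [splitPoint_apply, rightTerminal_apply, h2] at h0 h1
  rw [h0] at h1
  simp at h1

theorem leftTerminal_add_rightTerminal (i : Fin d) :
    leftTerminal i + rightTerminal i = (2 : ℝ) • splitPoint (simplexVertex d i) := by
  ext k
  simp only [PiLp.add_apply, PiLp.smul_apply, leftTerminal_apply, rightTerminal_apply,
    splitPoint_apply, simplexVertex_apply, Fin.ext_iff, smul_eq_mul]
  split_ifs <;> first | omega | norm_num

theorem inner_leftTerminal_sub_rightTerminal (i : Fin d) (x : EuclideanSpace ℝ (Fin d)) :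
    inner ℝ (leftTerminal i - rightTerminal i) (splitPoint x) = (0 : ℝ) := by
  have h2 : (⟨(2 * i.val + 1) / 2, by have := i.isLt; omega⟩ : Fin d)
    = ⟨2 * i.val / 2, by have := i.isLt; omega⟩ := Fin.ext (by simp only; omega)
  rw [inner_sub_left, leftTerminal, rightTerminal, inner_simplexVertex, inner_simplexVertex,
    splitPoint_apply, splitPoint_apply, h2, sub_self]

theorem norm_leftTerminal_sub_rightTerminal_sq (i : Fin d) :
    ‖(leftTerminal i - rightTerminal i : EuclideanSpace ℝ (Fin (2 * d)))‖ ^ 2 = 2 := by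
  have h : inner ℝ (leftTerminal i) (rightTerminal i) = (0 : ℝ) := by
    rw [leftTerminal, inner_simplexVertex, rightTerminal_apply, if_neg (by simp)]
  rw [norm_sub_sq_real, h, leftTerminal, rightTerminal, norm_simplexVertex, norm_simplexVertex]
  norm_num

/-! ### Explicit Fermat points of the new triangles -/

/-- The point of the segment from `e_i` to `s` at distance `1 / √3` from `e_i`. Its split is the
Fermat point of the new terminals belonging to `e_i` and the split of `s`. -/
noncomputable def fermatBase (i : Fin d) (s : EuclideanSpace ℝ (Fin d)) :
    EuclideanSpace ℝ (Fin d) :=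
  simplexVertex d i + (√3)⁻¹ • unitDir (simplexVertex d i) s

theorem inv_sqrt_three_lt {t : ℝ} (ht : 0 ≤ t) (h : 1 < 3 * t ^ 2) : (√3)⁻¹ < t := by
  have h3 : (√3)⁻¹ ^ 2 = 1 / 3 := by rw [inv_pow, Real.sq_sqrt (by norm_num)]; norm_num
  exact lt_of_pow_lt_pow_left₀ 2 ht (by rw [h3]; linarith)

theorem dist_fermatBase {i : Fin d} {s : EuclideanSpace ℝ (Fin d)} (hs : s ≠ simplexVertex d i) :
    dist (simplexVertex d i) (fermatBase i s) = (√3)⁻¹ := by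
  rw [fermatBase, dist_self_add_right, norm_smul, norm_unitDir hs, mul_one,
    Real.norm_of_nonneg (by positivity)]

theorem fermatBase_eq (i : Fin d) (s : EuclideanSpace ℝ (Fin d)) :
    fermatBase i s = s + (dist (simplexVertex d i) s - (√3)⁻¹) • unitDir s (simplexVertex d i) := by
  rw [sub_smul, dist_eq_norm, norm_smul_unitDir, unitDir_swap, fermatBase, smul_neg]
  abel

/-- The three legs at the Fermat point, in the orthogonal frame of the base direction `δ` and the
axis `n` of the isosceles triangle. Existence, uniqueness and angles are all read off from it. -/
theorem exists_fermat_frame {i : Fin d} {s : EuclideanSpace ℝ (Fin d)}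
    (hs : s ≠ simplexVertex d i) (h : 1 < 3 * dist (simplexVertex d i) s ^ 2) :
    ∃ (u v w : EuclideanSpace ℝ (Fin (2 * d))) (p r : ℝ), 0 < p ∧ 0 < r ∧ ‖u‖ = 1 ∧ ‖v‖ = 1 ∧
      ‖w‖ = 1 ∧ u + v + w = 0 ∧ leftTerminal i = splitPoint (fermatBase i s) + p • u ∧
      rightTerminal i = splitPoint (fermatBase i s) + p • v ∧
      splitPoint s = splitPoint (fermatBase i s) + r • w := by
  have h2 : √2 * √2 = 2 := Real.mul_self_sqrt (by norm_num)
  set ρ := (√3)⁻¹ with hρ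
  have hρ2 : ρ * ρ = 1 / 3 := by
    rw [hρ, ← mul_inv, Real.mul_self_sqrt (by norm_num)]; norm_num
  have hρpos : 0 < ρ := by positivity
  have hlt := inv_sqrt_three_lt dist_nonneg h
  set D := dist (simplexVertex d i) s with hD
  set e := unitDir (simplexVertex d i) s with he
  set δ := leftTerminal i - rightTerminal i with hδ
  set n := √2 • splitPoint e with hn
  have hnn : ‖n‖ = 1 := by rw [hn, norm_sqrt_two_smul_splitPoint, norm_unitDir hs]
  have hnδ : inner ℝ δ n = (0 : ℝ) := by
    rw [hn, real_inner_smul_right, inner_leftTerminal_sub_rightTerminal, mul_zero]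
  have hδ2 : ‖δ‖ ^ 2 = 2 := norm_leftTerminal_sub_rightTerminal_sq i
  -- Since `δ` has length `√2`, this makes `c • δ` of length `√3 / 2`, the sine of 120 degrees.
  set c := 3 / 4 * ρ * √2 with hc
  have hc2 : c ^ 2 = 3 / 8 := by
    rw [hc]
    linear_combination (9 / 16 * (√2 * √2)) * hρ2 + 3 / 16 * h2
  have hunit : ∀ t : ℝ, t ^ 2 = c ^ 2 → ‖t • δ - (1 / 2 : ℝ) • n‖ = 1 := by
    intro t ht
    rw [← sq_eq_sq₀ (norm_nonneg _) zero_le_one, norm_sub_sq_real, real_inner_smul_left,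
      real_inner_smul_right, hnδ, norm_smul, norm_smul, mul_pow, mul_pow, hδ2, hnn,
      Real.norm_eq_abs, Real.norm_eq_abs, sq_abs, sq_abs, ht, hc2]
    norm_num
  have hsplit : splitPoint e = (√2 / 2) • n := by
    rw [hn, smul_smul, show √2 / 2 * √2 = 1 by linarith, one_smul]
  have hx : splitPoint (fermatBase i s)
      = splitPoint (simplexVertex d i) + (ρ * (√2 / 2)) • n := by
    rw [fermatBase, splitPoint_add, splitPoint_smul, ← he, hsplit, smul_smul]
  have hsum := leftTerminal_add_rightTerminal i
  have hl : leftTerminal i = splitPoint (simplexVertex d i) + (1 / 2 : ℝ) • δ := by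
    have : splitPoint (simplexVertex d i) = (1 / 2 : ℝ) • (leftTerminal i + rightTerminal i) := by
      rw [hsum, smul_smul]; norm_num
    rw [this, hδ]; module
  have hr : rightTerminal i = splitPoint (simplexVertex d i) - (1 / 2 : ℝ) • δ := by
    have : splitPoint (simplexVertex d i) = (1 / 2 : ℝ) • (leftTerminal i + rightTerminal i) := by
      rw [hsum, smul_smul]; norm_num
    rw [this, hδ]; module
  have hpc : ρ * √2 * c = 1 / 2 := by
    rw [hc]
    linear_combination (3 / 4 * (√2 * √2)) * hρ2 + 1 / 4 * h2
  -- The last leg is positive precisely because the terminal edge is longer than `1 / √3`.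
  refine ⟨c • δ - (1 / 2 : ℝ) • n, (-c) • δ - (1 / 2 : ℝ) • n, n, ρ * √2, (D - ρ) * (√2 / 2),
    by positivity, mul_pos (sub_pos.2 hlt) (by positivity), hunit c rfl, hunit (-c) (by ring), hnn,
    by module, ?_, ?_, ?_⟩
  · rw [hx, hl, smul_sub (ρ * √2), smul_smul (ρ * √2) c, hpc]; module
  · rw [hx, hr, smul_sub (ρ * √2), smul_smul (ρ * √2) (-c), mul_neg, hpc]; module
  · have : s = simplexVertex d i + D • e := by
      rw [hD, dist_comm, dist_eq_norm, he, norm_smul_unitDir, add_sub_cancel]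
    conv_lhs => rw [this]
    rw [hx, splitPoint_add, splitPoint_smul, hsplit]; module

theorem isFermatPoint_fermatBase {i : Fin d} {s : EuclideanSpace ℝ (Fin d)}
    (hs : s ≠ simplexVertex d i) (h : 1 < 3 * dist (simplexVertex d i) s ^ 2) :
    IsFermatPoint (leftTerminal i) (rightTerminal i) (splitPoint s)
      (splitPoint (fermatBase i s)) := by
  obtain ⟨u, v, w, p, r, hp, hr, hu, hv, hw, hsum, hl, hri, hsp⟩ := exists_fermat_frame hs h
  refine ⟨splitPoint_ne_leftTerminal _ _, splitPoint_ne_rightTerminal _ _, ?_, fun y => ?_⟩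
  · rw [hsp]
    intro hh
    have : r • w = 0 := left_eq_add.1 hh
    rcases smul_eq_zero.1 this with h0 | h0
    · exact hr.ne' h0
    · rw [h0, norm_zero] at hw
      exact zero_ne_one hw
  · rw [hl, hri, hsp]
    exact dist_sum_le_of_unit_sum_eq_zero hp.le hp.le hr.le hu hv hw hsum y

theorem eq_of_isFermatPoint {i : Fin d} {s : EuclideanSpace ℝ (Fin d)}
    (hs : s ≠ simplexVertex d i) (h : 1 < 3 * dist (simplexVertex d i) s ^ 2)
    {y : EuclideanSpace ℝ (Fin (2 * d))}
    (hy : IsFermatPoint (leftTerminal i) (rightTerminal i) (splitPoint s) y) :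
    y = splitPoint (fermatBase i s) := by
  obtain ⟨u, v, w, p, r, hp, hr, hu, hv, hw, hsum, hl, hri, hsp⟩ := exists_fermat_frame hs h
  have := hy.2.2.2 (splitPoint (fermatBase i s))
  rw [hl, hri, hsp] at this
  exact eq_of_dist_sum_le_of_unit_sum_eq_zero hp.le hp.le hr.le hu hv hw hsum this

theorem inner_unitDir_fermat {i : Fin d} {s : EuclideanSpace ℝ (Fin d)}
    (hs : s ≠ simplexVertex d i) (h : 1 < 3 * dist (simplexVertex d i) s ^ 2)
    {a b : EuclideanSpace ℝ (Fin (2 * d))} (hab : a ≠ b)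
    (ha : a = leftTerminal i ∨ a = rightTerminal i ∨ a = splitPoint s)
    (hb : b = leftTerminal i ∨ b = rightTerminal i ∨ b = splitPoint s) :
    inner ℝ (unitDir (splitPoint (fermatBase i s)) a) (unitDir (splitPoint (fermatBase i s)) b)
      = (-(1 / 2) : ℝ) := by
  obtain ⟨u, v, w, p, r, hp, hr, hu, hv, hw, hsum, hl, hri, hsp⟩ := exists_fermat_frame hs h
  have hl' : unitDir (splitPoint (fermatBase i s)) (leftTerminal i) = u := by
    rw [hl, unitDir_add_smul hu hp]
  have hr' : unitDir (splitPoint (fermatBase i s)) (rightTerminal i) = v := by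
    rw [hri, unitDir_add_smul hv hp]
  have hs' : unitDir (splitPoint (fermatBase i s)) (splitPoint s) = w := by
    rw [hsp, unitDir_add_smul hw hr]
  have huv := inner_eq_of_sum_eq_zero hu hv hw hsum
  have huw := inner_eq_of_sum_eq_zero hu hw hv (by rw [← hsum]; abel)
  have hvw := inner_eq_of_sum_eq_zero hv hw hu (by rw [← hsum]; abel)
  rcases ha with rfl | rfl | rfl <;> rcases hb with rfl | rfl | rfl
  · exact absurd rfl hab
  · rw [hl', hr', huv]
  · rw [hl', hs', huw]
  · rw [hl', hr', real_inner_comm, huv]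
  · exact absurd rfl hab
  · rw [hr', hs', hvw]
  · rw [hl', hs', real_inner_comm, huw]
  · rw [hr', hs', real_inner_comm, hvw]
  · exact absurd rfl hab

end Split

/-! ### The doubled tree -/

section Doubling

variable {d : ℕ} {S : Finset (EuclideanSpace ℝ (Fin d))}
  {G : SimpleGraph (EuclideanSpace ℝ (Fin d))} {s : Fin d → EuclideanSpace ℝ (Fin d)}

/-- The new Fermat points. -/
noncomputable def newPoint (s : Fin d → EuclideanSpace ℝ (Fin d)) (i : Fin d) :
    EuclideanSpace ℝ (Fin (2 * d)) :=
  splitPoint (fermatBase i (s i))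

open Classical in
/-- The embedding of the old tree into the doubled tree: an old Steiner point goes to its split and
an old terminal to the corresponding Fermat point. -/
noncomputable def doublingMap (s : Fin d → EuclideanSpace ℝ (Fin d))
    (v : EuclideanSpace ℝ (Fin d)) : EuclideanSpace ℝ (Fin (2 * d)) :=
  if h : ∃ i, simplexVertex d i = v then newPoint s h.choose else splitPoint v

theorem doublingMap_simplexVertex (i : Fin d) :
    doublingMap s (simplexVertex d i) = newPoint s i := by
  have h : ∃ j, simplexVertex d j = simplexVertex d i := ⟨i, rfl⟩
  rw [doublingMap, dif_pos h, simplexVertex_injective h.choose_spec]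

theorem doublingMap_of_mem (h : IsSteinerTree (regularSimplex d) S G)
    {r : EuclideanSpace ℝ (Fin d)} (hr : r ∈ S) : doublingMap s r = splitPoint r := by
  rw [doublingMap, dif_neg]
  exact fun hh => Finset.disjoint_left.1 h.disjoint (mem_regularSimplex.2 hh) hr

theorem newPoint_ne_leftTerminal (i j : Fin d) : newPoint s i ≠ leftTerminal j :=
  splitPoint_ne_leftTerminal _ _

theorem newPoint_ne_rightTerminal (i j : Fin d) : newPoint s i ≠ rightTerminal j :=
  splitPoint_ne_rightTerminal _ _

theorem inner_unitDir_eq (h : IsOptimalSteinerTree (regularSimplex d) S G)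
    {r a b : EuclideanSpace ℝ (Fin d)} (hr : r ∈ S) (ha : G.Adj r a) (hb : G.Adj r b)
    (hab : a ≠ b) (hne : (regularSimplex d).Nonempty) :
    inner ℝ (unitDir r a) (unitDir r b) = (-(1 / 2) : ℝ) := by
  obtain ⟨c, e, hc, he, -, -, -, hall, hsum⟩ := h.exists_neighbors hr hne ha
  rcases hall b hb with rfl | rfl | rfl
  · exact absurd rfl hab
  · exact inner_eq_of_sum_eq_zero (norm_unitDir ha.ne') (norm_unitDir hb.ne')
      (norm_unitDir he.ne') hsum
  · exact inner_eq_of_sum_eq_zero (norm_unitDir ha.ne') (norm_unitDir hb.ne')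
      (norm_unitDir hc.ne') (by rw [← hsum]; abel)

/-- The unsplit points lie within `1 / √3` of terminals that are `√2 > 2 / √3` apart. -/
theorem newPoint_injective (hs : ∀ i, s i ≠ simplexVertex d i) :
    Function.Injective (newPoint s) := by
  intro i j hij
  by_contra hne
  have h0 := splitPoint_injective hij
  have h1 := dist_triangle (simplexVertex d i) (fermatBase i (s i)) (simplexVertex d j)
  rw [dist_fermatBase (hs i), h0, dist_comm (fermatBase _ _), dist_fermatBase (hs j)] at h1
  have h2 : dist (simplexVertex d i) (simplexVertex d j) ^ 2 = 2 := by
    rw [dist_eq_norm, norm_sub_sq_real, inner_simplexVertex, simplexVertex_apply, if_neg hne,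
      norm_simplexVertex, norm_simplexVertex]
    norm_num
  have h3 : (√3)⁻¹ ^ 2 = 1 / 3 := by rw [inv_pow, Real.sq_sqrt (by norm_num)]; norm_num
  have h4 : dist (simplexVertex d i) (simplexVertex d j) ^ 2 ≤ ((√3)⁻¹ + (√3)⁻¹) ^ 2 :=
    pow_le_pow_left₀ dist_nonneg h1 2
  nlinarith

/-- An optimal Steiner tree of the regular `d`-simplex, `d ≥ 3`, together with the neighbours `s i`
of its terminals. -/
structure IsDoublingData (S : Finset (EuclideanSpace ℝ (Fin d)))
    (G : SimpleGraph (EuclideanSpace ℝ (Fin d))) (s : Fin d → EuclideanSpace ℝ (Fin d)) :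
    Prop where
  optimal : IsOptimalSteinerTree (regularSimplex d) S G
  three_le : 3 ≤ d
  adj : ∀ i, G.Adj (simplexVertex d i) (s i)

namespace IsDoublingData

theorem nonempty (h : IsDoublingData S G s) : (regularSimplex d).Nonempty :=
  ⟨_, simplexVertex_mem ⟨0, by have := h.three_le; omega⟩⟩

theorem eq_of_adj (h : IsDoublingData S G s) {i : Fin d} {v : EuclideanSpace ℝ (Fin d)}
    (hv : G.Adj (simplexVertex d i) v) : v = s i :=
  (h.optimal.existsUnique_neighbor (by have := h.three_le; omega) i).unique hv (h.adj i)

theorem mem (h : IsDoublingData S G s) (i : Fin d) : s i ∈ S :=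
  h.optimal.neighbor_mem_steiner h.three_le (h.adj i)

theorem one_lt (h : IsDoublingData S G s) (i : Fin d) :
    1 < 3 * dist (simplexVertex d i) (s i) ^ 2 :=
  h.optimal.one_lt_three_mul_dist_sq h.three_le (h.adj i)

theorem simplexVertex_notMem (h : IsDoublingData S G s) (i : Fin d) : simplexVertex d i ∉ S :=
  Finset.disjoint_left.1 h.optimal.disjoint (simplexVertex_mem i)

theorem map_of_mem (h : IsDoublingData S G s) {r : EuclideanSpace ℝ (Fin d)} (hr : r ∈ S) :
    doublingMap s r = splitPoint r :=
  doublingMap_of_mem h.optimal.toIsSteinerTree hr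

/-- A Steiner point at `fermatBase i (s i)` would be nearer to `e_i` than its neighbour `s i`, and
reattaching the leaf there would shorten the tree. -/
theorem newPoint_ne_splitPoint (h : IsDoublingData S G s) (i : Fin d)
    {r : EuclideanSpace ℝ (Fin d)} (hr : r ∈ S) : newPoint s i ≠ splitPoint r := by
  intro hh
  have hmem : fermatBase i (s i) ∈ S := splitPoint_injective hh ▸ hr
  have h1 := h.optimal.dist_le_of_leaf (h.adj i) (fun w hw => h.eq_of_adj hw)
    (Finset.mem_union_right _ hmem) (fun he => h.simplexVertex_notMem i (he ▸ hmem))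
  rw [dist_fermatBase (h.adj i).ne'] at h1
  exact absurd h1 (not_le.2 (inv_sqrt_three_lt dist_nonneg (h.one_lt i)))

theorem newPoint_injective (h : IsDoublingData S G s) : Function.Injective (newPoint s) :=
  _root_.newPoint_injective fun i => (h.adj i).ne'

theorem mem_or (h : IsDoublingData S G s) {r w : EuclideanSpace ℝ (Fin d)} (hw : G.Adj r w) :
    w ∈ S ∨ ∃ i, w = simplexVertex d i ∧ r = s i := by
  rcases Finset.mem_union.1 (h.optimal.edges_mem _ _ hw).2 with hP | hS
  · obtain ⟨i, rfl⟩ := mem_regularSimplex.1 hP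
    exact Or.inr ⟨i, rfl, h.eq_of_adj hw.symm⟩
  · exact Or.inl hS

/-! #### Adjacency in the doubled tree -/

theorem adj_leftTerminal (i : Fin d) {v : EuclideanSpace ℝ (Fin (2 * d))} :
    (doubledGraph S G s (newPoint s)).Adj (leftTerminal i) v ↔ v = newPoint s i := by
  rw [doubledGraph, SimpleGraph.fromRel_adj]
  constructor
  · rintro ⟨-, (⟨r, -, q, -, -, hu, -⟩ | ⟨j, hu, hv⟩ | ⟨j, hu, -⟩ | ⟨j, hu, -⟩) |
      (⟨r, -, q, -, -, -, hu⟩ | ⟨j, -, hu⟩ | ⟨j, -, hu⟩ | ⟨j, -, hu⟩)⟩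
    · exact absurd hu.symm (splitPoint_ne_leftTerminal _ _)
    · rw [hv, leftTerminal_injective hu]
    · exact absurd hu (leftTerminal_ne_rightTerminal _ _)
    · exact absurd hu.symm (newPoint_ne_leftTerminal _ _)
    · exact absurd hu.symm (splitPoint_ne_leftTerminal _ _)
    · exact absurd hu.symm (newPoint_ne_leftTerminal _ _)
    · exact absurd hu.symm (newPoint_ne_leftTerminal _ _)
    · exact absurd hu.symm (splitPoint_ne_leftTerminal _ _)
  · rintro rfl
    exact ⟨(newPoint_ne_leftTerminal _ _).symm, Or.inl (Or.inr (Or.inl ⟨i, rfl, rfl⟩))⟩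

theorem adj_rightTerminal (i : Fin d) {v : EuclideanSpace ℝ (Fin (2 * d))} :
    (doubledGraph S G s (newPoint s)).Adj (rightTerminal i) v ↔ v = newPoint s i := by
  rw [doubledGraph, SimpleGraph.fromRel_adj]
  constructor
  · rintro ⟨-, (⟨r, -, q, -, -, hu, -⟩ | ⟨j, hu, -⟩ | ⟨j, hu, hv⟩ | ⟨j, hu, -⟩) |
      (⟨r, -, q, -, -, -, hu⟩ | ⟨j, -, hu⟩ | ⟨j, -, hu⟩ | ⟨j, -, hu⟩)⟩
    · exact absurd hu.symm (splitPoint_ne_rightTerminal _ _)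
    · exact absurd hu.symm (leftTerminal_ne_rightTerminal _ _)
    · rw [hv, rightTerminal_injective hu]
    · exact absurd hu.symm (newPoint_ne_rightTerminal _ _)
    · exact absurd hu.symm (splitPoint_ne_rightTerminal _ _)
    · exact absurd hu.symm (newPoint_ne_rightTerminal _ _)
    · exact absurd hu.symm (newPoint_ne_rightTerminal _ _)
    · exact absurd hu.symm (splitPoint_ne_rightTerminal _ _)
  · rintro rfl
    exact ⟨(newPoint_ne_rightTerminal _ _).symm,
      Or.inl (Or.inr (Or.inr (Or.inl ⟨i, rfl, rfl⟩)))⟩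

theorem adj_newPoint (h : IsDoublingData S G s) (i : Fin d)
    {v : EuclideanSpace ℝ (Fin (2 * d))} :
    (doubledGraph S G s (newPoint s)).Adj (newPoint s i) v ↔
      v = leftTerminal i ∨ v = rightTerminal i ∨ v = splitPoint (s i) := by
  rw [doubledGraph, SimpleGraph.fromRel_adj]
  constructor
  · rintro ⟨-, (⟨r, hr, q, -, -, hu, -⟩ | ⟨j, hu, -⟩ | ⟨j, hu, -⟩ | ⟨j, hu, hv⟩) |
      (⟨r, -, q, hq, -, -, hu⟩ | ⟨j, hv, hu⟩ | ⟨j, hv, hu⟩ | ⟨j, -, hu⟩)⟩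
    · exact absurd hu (h.newPoint_ne_splitPoint i hr)
    · exact absurd hu (newPoint_ne_leftTerminal _ _)
    · exact absurd hu (newPoint_ne_rightTerminal _ _)
    · rw [h.newPoint_injective hu]; exact Or.inr (Or.inr hv)
    · exact absurd hu (h.newPoint_ne_splitPoint i hq)
    · rw [h.newPoint_injective hu]; exact Or.inl hv
    · rw [h.newPoint_injective hu]; exact Or.inr (Or.inl hv)
    · exact absurd hu (h.newPoint_ne_splitPoint i (h.mem j))
  · rintro (rfl | rfl | rfl)
    · exact ⟨newPoint_ne_leftTerminal _ _, Or.inr (Or.inr (Or.inl ⟨i, rfl, rfl⟩))⟩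
    · exact ⟨newPoint_ne_rightTerminal _ _, Or.inr (Or.inr (Or.inr (Or.inl ⟨i, rfl, rfl⟩)))⟩
    · exact ⟨h.newPoint_ne_splitPoint i (h.mem i),
        Or.inl (Or.inr (Or.inr (Or.inr ⟨i, rfl, rfl⟩)))⟩

/-- Since no vertices coincide, no accidental edges appear, and the neighbourhood of an old Steiner
point is carried over by `doublingMap`. -/
theorem adj_splitPoint (h : IsDoublingData S G s) {r : EuclideanSpace ℝ (Fin d)} (hr : r ∈ S)
    {v : EuclideanSpace ℝ (Fin (2 * d))} :
    (doubledGraph S G s (newPoint s)).Adj (splitPoint r) v ↔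
      ∃ w, G.Adj r w ∧ v = doublingMap s w := by
  rw [doubledGraph, SimpleGraph.fromRel_adj]
  constructor
  · rintro ⟨-, (⟨r', -, q, hq, hrq, hu, hv⟩ | ⟨j, hu, -⟩ | ⟨j, hu, -⟩ | ⟨j, hu, -⟩) |
      (⟨q, hq, r', -, hrq, hv, hu⟩ | ⟨j, -, hu⟩ | ⟨j, -, hu⟩ | ⟨j, hv, hu⟩)⟩
    · rw [splitPoint_injective hu]
      exact ⟨q, hrq, by rw [hv, h.map_of_mem hq]⟩
    · exact absurd hu (splitPoint_ne_leftTerminal _ _)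
    · exact absurd hu (splitPoint_ne_rightTerminal _ _)
    · exact absurd hu.symm (h.newPoint_ne_splitPoint j hr)
    · rw [splitPoint_injective hu]
      exact ⟨q, hrq.symm, by rw [hv, h.map_of_mem hq]⟩
    · exact absurd hu.symm (h.newPoint_ne_splitPoint j hr)
    · exact absurd hu.symm (h.newPoint_ne_splitPoint j hr)
    · rw [splitPoint_injective hu]
      exact ⟨_, (h.adj j).symm, by rw [hv, doublingMap_simplexVertex]⟩
  · rintro ⟨w, hw, rfl⟩
    rcases h.mem_or hw with hwS | ⟨i, rfl, rfl⟩
    · rw [h.map_of_mem hwS]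
      exact ⟨fun hh => hw.ne (splitPoint_injective hh),
        Or.inl (Or.inl ⟨r, hr, w, hwS, hw, rfl, rfl⟩)⟩
    · rw [doublingMap_simplexVertex]
      exact ⟨(h.newPoint_ne_splitPoint i hr).symm,
        Or.inr (Or.inr (Or.inr (Or.inr ⟨i, rfl, rfl⟩)))⟩

theorem mem_doubledSteiner {v : EuclideanSpace ℝ (Fin (2 * d))} :
    v ∈ doubledSteiner S (newPoint s) ↔
      (∃ r ∈ S, splitPoint r = v) ∨ ∃ i, newPoint s i = v := by
  simp [doubledSteiner]

theorem disjoint_doubledSteiner :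
    Disjoint (regularSimplex (2 * d)) (doubledSteiner S (newPoint s)) := by
  rw [Finset.disjoint_left]
  intro v hv hv'
  obtain ⟨i, rfl | rfl⟩ := mem_regularSimplex_two_mul.1 hv <;>
    rcases mem_doubledSteiner.1 hv' with ⟨r, -, hr⟩ | ⟨j, hj⟩
  · exact splitPoint_ne_leftTerminal _ _ hr
  · exact newPoint_ne_leftTerminal _ _ hj
  · exact splitPoint_ne_rightTerminal _ _ hr
  · exact newPoint_ne_rightTerminal _ _ hj

theorem left_mem_vertices {u v : EuclideanSpace ℝ (Fin (2 * d))}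
    (h : IsDoublingData S G s) (huv : (doubledGraph S G s (newPoint s)).Adj u v) :
    u ∈ regularSimplex (2 * d) ∪ doubledSteiner S (newPoint s) := by
  rw [Finset.mem_union, mem_regularSimplex_two_mul, mem_doubledSteiner]
  rw [doubledGraph, SimpleGraph.fromRel_adj] at huv
  obtain ⟨-, (⟨r, hr, q, -, -, hu, -⟩ | ⟨j, hu, -⟩ | ⟨j, hu, -⟩ | ⟨j, hu, -⟩) |
      (⟨r, -, q, hq, -, -, hu⟩ | ⟨j, -, hu⟩ | ⟨j, -, hu⟩ | ⟨j, -, hu⟩)⟩ := huv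
  · exact Or.inr (Or.inl ⟨r, hr, hu.symm⟩)
  · exact Or.inl ⟨j, Or.inl hu⟩
  · exact Or.inl ⟨j, Or.inr hu⟩
  · exact Or.inr (Or.inr ⟨j, hu.symm⟩)
  · exact Or.inr (Or.inl ⟨q, hq, hu.symm⟩)
  · exact Or.inr (Or.inr ⟨j, hu.symm⟩)
  · exact Or.inr (Or.inr ⟨j, hu.symm⟩)
  · exact Or.inr (Or.inl ⟨s j, h.mem j, hu.symm⟩)

theorem edges_mem (h : IsDoublingData S G s) (u v : EuclideanSpace ℝ (Fin (2 * d)))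
    (huv : (doubledGraph S G s (newPoint s)).Adj u v) :
    u ∈ regularSimplex (2 * d) ∪ doubledSteiner S (newPoint s) ∧
      v ∈ regularSimplex (2 * d) ∪ doubledSteiner S (newPoint s) :=
  ⟨h.left_mem_vertices huv, h.left_mem_vertices huv.symm⟩

/-! #### Angles and degrees in the doubled tree -/

/-- Splitting is a similarity, and a terminal is replaced by a point on the same ray from its
neighbour; so directions at old Steiner points are just split and rescaled. -/
theorem unitDir_doublingMap (h : IsDoublingData S G s) {r w : EuclideanSpace ℝ (Fin d)}
    (hw : G.Adj r w) :
    unitDir (splitPoint r) (doublingMap s w) = √2 • splitPoint (unitDir r w) := by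
  have hn : ‖√2 • splitPoint (unitDir r w)‖ = 1 := by
    rw [norm_sqrt_two_smul_splitPoint, norm_unitDir hw.ne']
  have key : ∀ t : ℝ, 0 < t → unitDir (splitPoint r) (splitPoint (r + t • unitDir r w))
      = √2 • splitPoint (unitDir r w) := by
    intro t ht
    rw [splitPoint_add, splitPoint_smul, ← unitDir_add_smul (v := splitPoint r) hn
      (t := t * (√2)⁻¹) (by positivity), smul_smul, mul_assoc,
      inv_mul_cancel₀ (by positivity), mul_one]
  rcases h.mem_or hw with hwS | ⟨i, rfl, rfl⟩
  · rw [h.map_of_mem hwS, ← key _ (norm_pos_iff.2 (sub_ne_zero.2 hw.ne')), norm_smul_unitDir,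
      add_sub_cancel]
  · rw [doublingMap_simplexVertex, newPoint, fermatBase_eq]
    exact key _ (sub_pos.2 (inv_sqrt_three_lt dist_nonneg (h.one_lt i)))

theorem angle_eq (h : IsDoublingData S G s) {v a b : EuclideanSpace ℝ (Fin (2 * d))}
    (ha : (doubledGraph S G s (newPoint s)).Adj v a)
    (hb : (doubledGraph S G s (newPoint s)).Adj v b) (hab : a ≠ b) :
    EuclideanGeometry.angle a v b = 2 * Real.pi / 3 := by
  refine angle_eq_of_inner_unitDir_eq ?_
  rcases Finset.mem_union.1 (h.left_mem_vertices ha) with hv | hv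
  · obtain ⟨i, rfl | rfl⟩ := mem_regularSimplex_two_mul.1 hv
    · exact absurd (((adj_leftTerminal i).1 ha).trans ((adj_leftTerminal i).1 hb).symm) hab
    · exact absurd (((adj_rightTerminal i).1 ha).trans ((adj_rightTerminal i).1 hb).symm) hab
  · rcases mem_doubledSteiner.1 hv with ⟨r, hr, rfl⟩ | ⟨i, rfl⟩
    · obtain ⟨a', ha', rfl⟩ := (h.adj_splitPoint hr).1 ha
      obtain ⟨b', hb', rfl⟩ := (h.adj_splitPoint hr).1 hb
      rw [h.unitDir_doublingMap ha', h.unitDir_doublingMap hb', real_inner_smul_left,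
        real_inner_smul_right, inner_splitPoint, inner_unitDir_eq h.optimal hr ha' hb'
        (fun hh => hab (by rw [hh])) h.nonempty]
      linear_combination (-(1 / 4)) * Real.mul_self_sqrt (zero_le_two (α := ℝ))
    · exact inner_unitDir_fermat (h.adj i).ne' (h.one_lt i) hab ((h.adj_newPoint i).1 ha)
        ((h.adj_newPoint i).1 hb)

theorem ncard_neighborSet_steiner (h : IsDoublingData S G s)
    {v : EuclideanSpace ℝ (Fin (2 * d))} (hv : v ∈ doubledSteiner S (newPoint s)) :
    ((doubledGraph S G s (newPoint s)).neighborSet v).ncard = 3 := by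
  rcases mem_doubledSteiner.1 hv with ⟨r, hr, rfl⟩ | ⟨i, rfl⟩
  · have himg : (doubledGraph S G s (newPoint s)).neighborSet (splitPoint r)
        = doublingMap s '' G.neighborSet r := by
      ext v
      rw [SimpleGraph.mem_neighborSet, h.adj_splitPoint hr]
      exact ⟨fun ⟨w, hw, hv⟩ => ⟨w, hw, hv.symm⟩, fun ⟨w, hw, hv⟩ => ⟨w, hw, hv.symm⟩⟩
    rw [himg, Set.InjOn.ncard_image, h.optimal.ncard_neighborSet_eq_three hr h.nonempty]
    intro a ha b hb hab
    rcases h.mem_or ha with haS | ⟨i, rfl, -⟩ <;> rcases h.mem_or hb with hbS | ⟨j, rfl, -⟩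
    · rw [h.map_of_mem haS, h.map_of_mem hbS] at hab
      exact splitPoint_injective hab
    · rw [h.map_of_mem haS, doublingMap_simplexVertex] at hab
      exact absurd hab.symm (h.newPoint_ne_splitPoint j haS)
    · rw [h.map_of_mem hbS, doublingMap_simplexVertex] at hab
      exact absurd hab (h.newPoint_ne_splitPoint i hbS)
    · rw [doublingMap_simplexVertex, doublingMap_simplexVertex] at hab
      rw [h.newPoint_injective hab]
  · exact Set.ncard_eq_three.2 ⟨_, _, _, leftTerminal_ne_rightTerminal i i,
      (splitPoint_ne_leftTerminal (s i) i).symm, (splitPoint_ne_rightTerminal (s i) i).symm,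
      Set.ext fun v => h.adj_newPoint i⟩

/-! ### Counting and connectivity: the doubled graph is a tree -/

theorem card_doubledSteiner (h : IsDoublingData S G s) :
    (doubledSteiner S (newPoint s)).card + 2 = 2 * d := by
  classical
  have h1 : doubledSteiner S (newPoint s)
      = S.image splitPoint ∪ Finset.univ.image (newPoint s) := by
    ext v; rw [mem_doubledSteiner]; simp
  have h2 : Disjoint (S.image splitPoint) (Finset.univ.image (newPoint s)) := by
    rw [Finset.disjoint_left]
    intro v hv hv'
    obtain ⟨r, hr, rfl⟩ := Finset.mem_image.1 hv
    obtain ⟨i, -, hi⟩ := Finset.mem_image.1 hv'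
    exact h.newPoint_ne_splitPoint i hr hi
  have h3 := h.optimal.card_steiner h.three_le
  rw [h1, Finset.card_union_of_disjoint h2, Finset.card_image_of_injective _ splitPoint_injective,
    Finset.card_image_of_injective _ h.newPoint_injective, Finset.card_univ, Fintype.card_fin]
  omega

theorem adj_doublingMap (h : IsDoublingData S G s) {u v : EuclideanSpace ℝ (Fin d)}
    (huv : G.Adj u v) :
    (doubledGraph S G s (newPoint s)).Adj (doublingMap s u) (doublingMap s v) := by
  rcases h.mem_or huv.symm with hu | ⟨i, rfl, rfl⟩
  · rw [h.map_of_mem hu, h.adj_splitPoint hu]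
    exact ⟨v, huv, rfl⟩
  · rw [doublingMap_simplexVertex, h.map_of_mem (h.mem i), h.adj_newPoint]
    exact Or.inr (Or.inr rfl)

theorem connected (h : IsDoublingData S G s) : ((doubledGraph S G s (newPoint s)).induce
    {x | x ∈ regularSimplex (2 * d) ∪ doubledSteiner S (newPoint s)}).Connected := by
  have i₀ : Fin d := ⟨0, by have := h.three_le; omega⟩
  have hold : ∀ v ∈ regularSimplex d ∪ S,
      (doubledGraph S G s (newPoint s)).Reachable (newPoint s i₀) (doublingMap s v) := by
    intro v hv
    rw [← doublingMap_simplexVertex]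
    exact SimpleGraph.reachable_map_of_forall_adj (doublingMap s)
      (fun x y hxy => (h.adj_doublingMap hxy).reachable)
      (h.optimal.reachable (Finset.mem_union_left _ (simplexVertex_mem i₀)) hv)
  have hnew : ∀ i, (doubledGraph S G s (newPoint s)).Reachable (newPoint s i₀) (newPoint s i) := by
    intro i
    rw [← doublingMap_simplexVertex i]
    exact hold _ (Finset.mem_union_left _ (simplexVertex_mem i))
  refine SimpleGraph.connected_induce_of_reachable (x := newPoint s i₀) h.edges_mem
    (Finset.mem_union_right _ (mem_doubledSteiner.2 (Or.inr ⟨i₀, rfl⟩))) fun v hv => ?_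
  rcases Finset.mem_union.1 hv with hv | hv
  · obtain ⟨i, rfl | rfl⟩ := mem_regularSimplex_two_mul.1 hv
    · exact (hnew i).trans ((adj_leftTerminal i).2 rfl).symm.reachable
    · exact (hnew i).trans ((adj_rightTerminal i).2 rfl).symm.reachable
  · rcases mem_doubledSteiner.1 hv with ⟨r, hr, rfl⟩ | ⟨i, rfl⟩
    · rw [← h.map_of_mem hr]
      exact hold r (Finset.mem_union_right _ hr)
    · exact hnew i

theorem isSteinerTree (h : IsDoublingData S G s) : IsSteinerTree (regularSimplex (2 * d))
    (doubledSteiner S (newPoint s)) (doubledGraph S G s (newPoint s)) := by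
  classical
  refine ⟨disjoint_doubledSteiner, h.edges_mem, ?_⟩
  rw [SimpleGraph.isTree_induce_iff _ h.edges_mem]
  refine ⟨h.connected, ?_⟩
  have h1 : ∑ v ∈ regularSimplex (2 * d),
      ((doubledGraph S G s (newPoint s)).neighborSet v).ncard = 2 * d := by
    rw [Finset.sum_congr rfl (g := fun _ => 1), Finset.sum_const, card_regularSimplex, smul_eq_mul,
      mul_one]
    intro v hv
    obtain ⟨i, rfl | rfl⟩ := mem_regularSimplex_two_mul.1 hv
    · exact Set.ncard_eq_one.2 ⟨newPoint s i, Set.ext fun w => adj_leftTerminal i⟩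
    · exact Set.ncard_eq_one.2 ⟨newPoint s i, Set.ext fun w => adj_rightTerminal i⟩
  have h2 : ∑ v ∈ doubledSteiner S (newPoint s),
      ((doubledGraph S G s (newPoint s)).neighborSet v).ncard
        = (doubledSteiner S (newPoint s)).card * 3 := by
    rw [Finset.sum_congr rfl (g := fun _ => 3), Finset.sum_const, smul_eq_mul]
    exact fun v hv => h.ncard_neighborSet_steiner hv
  have h3 := h.card_doubledSteiner
  rw [Finset.sum_union disjoint_doubledSteiner, h1, h2,
    Finset.card_union_of_disjoint disjoint_doubledSteiner, card_regularSimplex]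
  omega

end IsDoublingData

end Doubling

theorem mainTheorem2 (d : ℕ) (hd : 3 ≤ d) (S : Finset (EuclideanSpace ℝ (Fin d)))
    (G : SimpleGraph (EuclideanSpace ℝ (Fin d)))
    (hT : IsOptimalSteinerTree (regularSimplex d) S G) :
    -- every terminal has exactly one neighbour `s_i`, and it is a Steiner point
    (∀ i, ∃! v, G.Adj (simplexVertex d i) v) ∧
    (∀ i v, G.Adj (simplexVertex d i) v → v ∈ S) ∧
    ∀ s : Fin d → EuclideanSpace ℝ (Fin d), (∀ i, G.Adj (simplexVertex d i) (s i)) →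
      -- the Fermat points `x_i` exist and are unique
      (∀ i, ∃! y, IsFermatPoint (leftTerminal i) (rightTerminal i) (splitPoint (s i)) y) ∧
      ∀ x : Fin d → EuclideanSpace ℝ (Fin (2 * d)),
        (∀ i, IsFermatPoint (leftTerminal i) (rightTerminal i) (splitPoint (s i)) (x i)) →
        -- the procedure yields a full, candidate-optimal Steiner tree, with all angles 120 degrees
        IsFullSteinerTree (regularSimplex (2 * d)) (doubledSteiner S x) (doubledGraph S G s x) ∧
        IsCandidateOptimal (regularSimplex (2 * d)) (doubledSteiner S x) (doubledGraph S G s x) ∧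
        ∀ v a b, (doubledGraph S G s x).Adj v a → (doubledGraph S G s x).Adj v b → a ≠ b →
          EuclideanGeometry.angle a v b = 2 * Real.pi / 3 := by
  refine ⟨hT.existsUnique_neighbor (by omega), fun i v hv => hT.neighbor_mem_steiner hd hv,
    fun s hs => ?_⟩
  have h : IsDoublingData S G s := ⟨hT, hd, hs⟩
  refine ⟨fun i => ⟨_, isFermatPoint_fermatBase (h.adj i).ne' (h.one_lt i),
    fun y hy => eq_of_isFermatPoint (h.adj i).ne' (h.one_lt i) hy⟩, fun x hx => ?_⟩
  -- By uniqueness, any family of Fermat points is the explicit one.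
  obtain rfl : x = newPoint s :=
    funext fun i => eq_of_isFermatPoint (h.adj i).ne' (h.one_lt i) (hx i)
  exact ⟨⟨h.isSteinerTree, by rw [h.card_doubledSteiner, card_regularSimplex]⟩,
    ⟨h.isSteinerTree, fun v a b ha hb hab => (h.angle_eq ha hb hab).ge,
      fun v hv => h.ncard_neighborSet_steiner hv⟩,
    fun v a b ha hb hab => h.angle_eq ha hb hab⟩
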